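/- Let $1\le k\le d$ be integers, $\varepsilon>0$ and $\beta\in(0,1)$. An input is a histogram $h\in\mathbb{N}^d$; two histograms are neighbouring, $h\sim h'$, if one arises from the other by adding the votes of one person, that is, by adding $1$ to the entries in some set $V\subseteq\{1,\dots,d\}$. Let $\mathcal{Y}$ be the set of sequences $s=(s[1],\dots,s[k])$ of distinct elements of $\{1,\dots,d\}$, let $h_{(i)}$ be the $i$-th largest entry of $h$, and put $$\mathrm{L}(h,s)=\max_{1\le i\le k}\bigl(h_{(i)}-h[s[i]]\bigr),\qquad \tau=\Bigl\lceil \tfrac{2}{\varepsilon}\ln\tfrac{\binom{d}{k}\,k!}{\beta}\Bigr\rceil,\qquad \mathrm{L}_{\mathcal A}(h,s)=\min\bigl(\mathrm{L}(h,s),\tau\bigr).$$ Let $\Delta_{\mathcal A}=\max_{h\sim h',\,s\in\mathcal Y}|\mathrm{L}_{\mathcal A}(h,s)-\mathrm{L}_{\mathcal A}(h',s)|$ be the sensitivity of $\mathrm{L}_{\mathcal A}$, and let $\mathcal A$ be the exponential mechanism, i.e. the randomized map from $\mathbb{N}^d$ to $\mathcal Y$ with $$\Pr[\mathcal A(h)=s]\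 \propto\ \exp\bigl(-\varepsilon\,\mathrm{L}_{\mathcal A}(h,s)/(2\Delta_{\mathcal A})\bigr)$$ (if $d=k=1$, the only case with $\Delta_{\mathcal A}=0$, the set $\mathcal Y$ has a single element, which $\mathcal A$ returns). Then: 1. $\mathcal A$ is $\varepsilon$-differentially private: $\Pr[\mathcal A(h)\in Z]\le e^{\varepsilon}\Pr[\mathcal A(h')\in Z]$ for all $h\sim h'$ and all $Z\subseteq\mathcal Y$. 2. $\Pr[\mathrm{L}(h,\mathcal A(h))\ge\tau]\le\beta$ for every $h\in\mathbb{N}^d$. 3. $\mathcal A$ can be implemented in $O(d+k\tau)$ time and space: there are one program and one constant $C$, independent of $d,k,\varepsilon,\beta,h$, such that on every input $(h,k,\varepsilon,\beta)$ the program always halts within $C(d+k\tau)$ steps, uses at most $C(d+k\tau)$ memory cells (input included), and outputs a sequence distributed exactly as $\mathcal A(h)$. The machine in 3 is a unit-cost randomized random access machine with exact arithmetic. It has a fixed number of registers, and arrays whose cells are addressed by natural numbers and each hold a natural number or a real number. Its unit-cost operations are loading and storing a cell; $+,-,\times,\div$, remainder and comparison of natural numbers; $+,-,\times,\div,\exp,\ln$,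 comparison, and rounding down to a natural number for reals; drawing a uniformly random element of $\{0,\dots,m-1\}$; and flipping a coin of given real bias. Space is the number of distinct cells that hold the input or are accessed. -/

import Mathlib

open scoped ENNReal NNReal

noncomputable section

namespace TopK

/-! ## Differential privacy and the exponential mechanism -/

/-- `M` is `(ε, δ)`-differentially private for the neighbouring relation `nbr`. -/
def IsDP {X Y : Type} (nbr : X → X → Prop) (M : X → PMF Y) (ε δ : ℝ) : Prop :=
  ∀ x x' : X, nbr x x' → ∀ Z : Set Y,
    (M x).toOuterMeasure Z ≤
      ENNReal.ofReal (Real.exp ε) * (M x').toOuterMeasure Z + ENNReal.ofReal δ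

/-- The sensitivity of a loss function: the largest value of `|loss x y - loss x' y|`
over neighbouring `x, x'` and all outputs `y`. -/
def sensitivity {X Y : Type} (nbr : X → X → Prop) (loss : X → Y → ℝ) : ℝ :=
  sSup {r : ℝ | ∃ (x x' : X) (y : Y), nbr x x' ∧ r = |loss x y - loss x' y|}

/-- The unnormalized weight of the output `y` in the exponential mechanism. -/
def expWeight {X Y : Type} (nbr : X → X → Prop) (loss : X → Y → ℝ) (ε : ℝ) (x : X) (y : Y) :
    ℝ≥0∞ :=
  ENNReal.ofReal (Real.exp (-(ε * loss x y / (2 * sensitivity nbr loss))))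

theorem tsum_expWeight_ne_zero {X Y : Type} [Nonempty Y] (nbr : X → X → Prop)
    (loss : X → Y → ℝ) (ε : ℝ) (x : X) : (∑' y, expWeight nbr loss ε x y) ≠ 0 := by
  obtain ⟨y⟩ := (inferInstance : Nonempty Y)
  intro h
  have h1 := ENNReal.tsum_eq_zero.1 h y
  simp only [expWeight, ENNReal.ofReal_eq_zero] at h1
  exact absurd h1 (not_le.2 (Real.exp_pos _))

theorem tsum_expWeight_ne_top {X Y : Type} [Fintype Y] (nbr : X → X → Prop)
    (loss : X → Y → ℝ) (ε : ℝ) (x : X) : (∑' y, expWeight nbr loss ε x y) ≠ ∞ := by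
  rw [tsum_fintype]
  exact (ENNReal.sum_lt_top.2 fun y _ => ENNReal.ofReal_lt_top).ne

/-- The exponential mechanism: the output `y` has probability proportional to
`exp (- ε * loss x y / (2 * sensitivity))`. -/
def expMechanism {X Y : Type} [Fintype Y] [Nonempty Y] (nbr : X → X → Prop)
    (loss : X → Y → ℝ) (ε : ℝ) (x : X) : PMF Y :=
  PMF.normalize (expWeight nbr loss ε x) (tsum_expWeight_ne_zero nbr loss ε x)
    (tsum_expWeight_ne_top nbr loss ε x)

/-! ## Top-`k` selection

The items are the elements of `Fin d`, a histogram is a function `Fin d → ℕ`, and a length-`k`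
sequence of distinct items is an embedding `Fin k ↪ Fin d`. -/

/-- One histogram arises from the other by adding the votes of one person, who votes exactly
for the items in `V`. -/
def Neighbor {d : ℕ} (h h' : Fin d → ℕ) : Prop :=
  ∃ V : Finset (Fin d),
    (∀ i, h' i = h i + if i ∈ V then 1 else 0) ∨ (∀ i, h i = h' i + if i ∈ V then 1 else 0)

/-- The `i`-th largest entry of `h`, with `i` counted from `0`. -/
def ithLargest {d : ℕ} (h : Fin d → ℕ) (i : Fin d) : ℕ := h (Tuple.sort h i.rev)

/-- The Joint loss `max_i (h_(i) - h[s[i]])`. -/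
def jointLoss {d k : ℕ} (hkd : k ≤ d) (h : Fin d → ℕ) (s : Fin k ↪ Fin d) : ℝ :=
  ⨆ i : Fin k, ((ithLargest h (Fin.castLE hkd i) : ℝ) - (h (s i) : ℝ))

/-- The threshold `τ = ⌈(2 / ε) * ln (C(d,k) * k! / β)⌉`. -/
def threshold (d k : ℕ) (ε β : ℝ) : ℕ :=
  ⌈2 / ε * Real.log ((d.choose k : ℝ) * (k.factorial : ℝ) / β)⌉₊

/-- The Joint loss truncated at `τ`. -/
def truncLoss {d k : ℕ} (hkd : k ≤ d) (τ : ℕ) (h : Fin d → ℕ) (s : Fin k ↪ Fin d) : ℝ :=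
  min (jointLoss hkd h s) (τ : ℝ)

/-- The exponential mechanism over length-`k` sequences of distinct items with the
truncated loss. -/
def topKMechanism {d k : ℕ} (hkd : k ≤ d) (ε β : ℝ) (h : Fin d → ℕ) : PMF (Fin k ↪ Fin d) :=
  haveI : Nonempty (Fin k ↪ Fin d) := ⟨Fin.castLEEmb hkd⟩
  expMechanism Neighbor (truncLoss hkd (threshold d k ε β)) ε h

/-! ## The machine model

A randomized random access machine with exact real arithmetic. It has natural-number registers
and real registers, and memory organized in natural-number arrays and real arrays whose cells are
addressed by natural numbers. A program is a fixed finite text, independent of the input.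
Every step executes one instruction or one test and costs one unit of time. -/

/-- Natural-number expressions over the natural-number registers (`sub` is truncated). -/
inductive NExpr : Type where
  | const (n : ℕ)
  | reg (x : ℕ)
  | add (a b : NExpr)
  | sub (a b : NExpr)
  | mul (a b : NExpr)
  | div (a b : NExpr)
  | mod (a b : NExpr)

/-- Real expressions over the registers; `cast` converts a natural number to a real number. There
are no real constants besides those that can be computed from natural numbers. -/
inductive RExpr : Type where
  | reg (x : ℕ)
  | cast (a : NExpr)
  | add (a b : RExpr)
  | sub (a b : RExpr)
  | mul (a b : RExpr)
  | div (a b : RExpr)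
  | exp (a : RExpr)
  | log (a : RExpr)

/-- Tests. -/
inductive Test : Type where
  | natLE (a b : NExpr)
  | natLT (a b : NExpr)
  | realLE (a b : RExpr)
  | realLT (a b : RExpr)

/-- Instructions. Expressions read registers only; memory is accessed by the load and store
instructions, each of which accesses a single cell. As the program is fixed, an instruction
performs a bounded number of arithmetic operations. -/
inductive Instr : Type where
  /-- put the value of `e` into the natural-number register `x` -/
  | natSet (x : ℕ) (e : NExpr)
  /-- put the value of `e` into the real register `x` -/
  | realSet (x : ℕ) (e : RExpr)
  /-- put `⌊e⌋` (zero if `e` is negative) into the natural-number register `x` -/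
  | floor (x : ℕ) (e : RExpr)
  /-- load cell number `e` of the natural-number array `a` into the register `x` -/
  | natLoad (x a : ℕ) (e : NExpr)
  /-- store the value of `v` in cell number `e` of the natural-number array `a` -/
  | natStore (a : ℕ) (e v : NExpr)
  /-- load cell number `e` of the real array `a` into the real register `x` -/
  | realLoad (x a : ℕ) (e : NExpr)
  /-- store the value of `v` in cell number `e` of the real array `a` -/
  | realStore (a : ℕ) (e : NExpr) (v : RExpr)
  /-- draw a fresh uniformly random element of `{0, ..., e - 1}` (zero if `e` is zero) -/
  | uniform (x : ℕ) (e : NExpr)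
  /-- draw a fresh coin: `1` with probability `p` (clipped to `[0, 1]`), otherwise `0` -/
  | coin (x : ℕ) (p : RExpr)

/-- Programs. -/
inductive Prog : Type where
  | instr (i : Instr)
  | seq (p q : Prog)
  | cond (b : Test) (p q : Prog)
  | loop (b : Test) (p : Prog)

/-- Names of memory cells: `Sum.inl (a, i)` is cell `i` of the natural-number array `a`, and
`Sum.inr (a, i)` is cell `i` of the real array `a`. -/
abbrev Cell : Type := (ℕ × ℕ) ⊕ (ℕ × ℕ)

/-- The store of the machine, together with the set of all memory cells that hold the input or
have been accessed so far. -/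
structure Store : Type where
  nreg : ℕ → ℕ
  rreg : ℕ → ℝ
  nmem : ℕ → ℕ → ℕ
  rmem : ℕ → ℕ → ℝ
  touched : Finset Cell

/-- The value of a natural-number expression. -/
def NExpr.eval (s : Store) : NExpr → ℕ
  | .const n => n
  | .reg x => s.nreg x
  | .add a b => a.eval s + b.eval s
  | .sub a b => a.eval s - b.eval s
  | .mul a b => a.eval s * b.eval s
  | .div a b => a.eval s / b.eval s
  | .mod a b => a.eval s % b.eval s

/-- The value of a real expression. -/
def RExpr.eval (s : Store) : RExpr → ℝ
  | .reg x => s.rreg x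
  | .cast a => (a.eval s : ℝ)
  | .add a b => a.eval s + b.eval s
  | .sub a b => a.eval s - b.eval s
  | .mul a b => a.eval s * b.eval s
  | .div a b => a.eval s / b.eval s
  | .exp a => Real.exp (a.eval s)
  | .log a => Real.log (a.eval s)

/-- The truth value of a test. -/
def Test.holds (s : Store) : Test → Prop
  | .natLE a b => a.eval s ≤ b.eval s
  | .natLT a b => a.eval s < b.eval s
  | .realLE a b => a.eval s ≤ b.eval s
  | .realLT a b => a.eval s < b.eval s

/-- Assign to a natural-number register. -/
def Store.setN (s : Store) (x v : ℕ) : Store :=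
  { s with nreg := Function.update s.nreg x v }

/-- Assign to a real register. -/
def Store.setR (s : Store) (x : ℕ) (v : ℝ) : Store :=
  { s with rreg := Function.update s.rreg x v }

/-- Record an access to a memory cell. -/
def Store.touch (s : Store) (c : Cell) : Store :=
  { s with touched := insert c s.touched }

/-- Write to a cell of a natural-number array. -/
def Store.writeN (s : Store) (a i v : ℕ) : Store :=
  { s with nmem := Function.update s.nmem a (Function.update (s.nmem a) i v) }

/-- Write to a cell of a real array. -/
def Store.writeR (s : Store) (a i : ℕ) (v : ℝ) : Store :=
  { s with rmem := Function.update s.rmem a (Function.update (s.rmem a) i v) }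

/-- The uniform distribution on `{0, ..., n - 1}`, and the point mass at `0` if `n = 0`. -/
def uniformBelow (n : ℕ) : PMF ℕ :=
  if hn : 0 < n then
    PMF.uniformOfFinset (Finset.range n) (Finset.nonempty_range_iff.2 hn.ne')
  else PMF.pure 0

/-- The distribution of a coin that shows `1` with probability `p`, clipped to `[0, 1]`. -/
def coinFlip (p : ℝ) : PMF ℕ :=
  (PMF.bernoulli (min p.toNNReal 1) (min_le_right _ _)).map fun b => if b then 1 else 0

/-- The effect of an instruction. -/
def Instr.exec (s : Store) : Instr → PMF Store
  | .natSet x e => PMF.pure (s.setN x (e.eval s))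
  | .realSet x e => PMF.pure (s.setR x (e.eval s))
  | .floor x e => PMF.pure (s.setN x ⌊e.eval s⌋₊)
  | .natLoad x a e =>
      PMF.pure ((s.setN x (s.nmem a (e.eval s))).touch (Sum.inl (a, e.eval s)))
  | .natStore a e v =>
      PMF.pure ((s.writeN a (e.eval s) (v.eval s)).touch (Sum.inl (a, e.eval s)))
  | .realLoad x a e =>
      PMF.pure ((s.setR x (s.rmem a (e.eval s))).touch (Sum.inr (a, e.eval s)))
  | .realStore a e v =>
      PMF.pure ((s.writeR a (e.eval s) (v.eval s)).touch (Sum.inr (a, e.eval s)))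
  | .uniform x e => (uniformBelow (e.eval s)).map fun v => s.setN x v
  | .coin x p => (coinFlip (p.eval s)).map fun v => s.setN x v

/-- A configuration: the list of programs that remain to be executed, and the store. -/
abbrev Config : Type := List Prog × Store

open Classical in
/-- One step of the machine. A configuration with nothing left to execute has halted. -/
def step : Config → PMF Config
  | ([], s) => PMF.pure ([], s)
  | (.instr i :: K, s) => (i.exec s).map fun s' => (K, s')
  | (.seq p q :: K, s) => PMF.pure (p :: q :: K, s)
  | (.cond b p q :: K, s) => PMF.pure (if b.holds s then (p :: K, s) else (q :: K, s))
  | (.loop b p :: K, s) => PMF.pure (if b.holds s then (p :: .loop b p :: K, s) else (K, s))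

/-- The distribution of the configuration after `n` steps. -/
def run : ℕ → Config → PMF Config
  | 0, c => PMF.pure c
  | n + 1, c => (step c).bind (run n)

/-- The initial store on input `h, k, ε, β`: the numbers `d` and `k` are in the natural-number
registers `0` and `1`, the numbers `ε` and `β` in the real registers `0` and `1`, and `h` is in the
first `d` cells of the natural-number array `0`. Everything else is zero. -/
def inputStore {d : ℕ} (h : Fin d → ℕ) (k : ℕ) (ε β : ℝ) : Store where
  nreg := fun x => if x = 0 then d else if x = 1 then k else 0
  rreg := fun x => if x = 0 then ε else if x = 1 then β else 0
  nmem := fun a i => if a = 0 then (if hi : i < d then h ⟨i, hi⟩ else 0) else 0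
  rmem := fun _ _ => 0
  touched := (Finset.range d).image fun i => Sum.inl (0, i)

/-- The output of a configuration: the first `k` cells of the natural-number array `1`. -/
def output (k : ℕ) (c : Config) : Fin k → ℕ := fun i => c.2.nmem 1 i

/-- On the given input, the program `P` halts after at most `t` steps, has used at most `m` memory
cells (those of the input included), whatever the outcome of its random draws, and its output has
the same distribution as the random sequence with distribution `μ`. -/
def SamplesWithin (P : Prog) {d k : ℕ} (h : Fin d → ℕ) (ε β : ℝ) (μ : PMF (Fin k ↪ Fin d))
    (t m : ℕ) : Prop :=
  (∀ c ∈ (run t ([P], inputStore h k ε β)).support, c.1 = [] ∧ c.2.touched.card ≤ m) ∧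
    (run t ([P], inputStore h k ε β)).map (output k) = μ.map fun s i => (s i : ℕ)

end TopK

end

open TopK

/-! Privacy and utility are the standard analysis of the exponential mechanism. The votes of one
person raise `h_(i)` and `h[s[i]]` each by 0 or 1 in the same direction, so the loss moves by at
most 1, and truncation keeps this. Hence the sensitivity is 1 once `d ≥ 2`. The sorted sequence has
loss 0, so the normalizer is at least 1, and `τ` is chosen so that a union bound over all sequences
gives `β`.

For sampling, `exp (-(ε * min l τ / 2))` is written as a layer-cake sum (`sum_ite_sub_add_eq`): the
drops of the decay over the levels `r < τ` with `l ≤ r`, plus the decay at `τ`. So the mechanism is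
a mixture of uniform laws on the level sets `{L ≤ r}` and of the uniform law on all sequences. A
sequence has `L ≤ r` iff each `s[j]` is among the items with at least `h_(j) - r` votes. These sets
are nested prefixes of the sorted order, of lengths `c j`, so a level set has `∏ (c j - j)` elements
and a Fisher–Yates shuffle confined to these prefixes samples it uniformly (`shuffleLaw_apply`). The
level is drawn by weighted reservoir sampling (`reservoirLaw_apply_mul`).

This costs `O(d + kτ)` if sorting is linear and each `c j` takes constant time. Unit-cost exact
arithmetic gives both: the histogram is packed into one integer with digits 0 and 1 in base `d + 2`.
Logarithms read off the largest key (`floor_log_packedTail`), and one division and one remainder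
modulo `d + 1` count the items above a bound (`packed_div_mod`). -/

namespace TopK

/-! ### Rules for reasoning about runs of the machine -/

theorem run_nil (n : ℕ) (s : Store) : run n ([], s) = PMF.pure ([], s) := by
  induction n with
  | zero => rfl
  | succ n ih => simp [run, step, ih]

theorem run_add (m n : ℕ) (c : Config) : run (m + n) c = (run m c).bind (run n) := by
  induction m generalizing c with
  | zero => simp [run]
  | succ m ih =>
    rw [Nat.succ_add, run, run, PMF.bind_bind]
    congr 1
    funext c'
    exact ih c'

/-- Started in `c`, the machine surely halts within `t` steps and its output has law `ν`. -/
def Yields {k : ℕ} (c : Config) (t : ℕ) (ν : PMF (Fin k → ℕ)) : Prop :=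
  (∀ c' ∈ (run t c).support, c'.1 = []) ∧ (run t c).map (output k) = ν

namespace Yields

variable {k : ℕ} {ν : PMF (Fin k → ℕ)} {c c' : Config} {s : Store} {K : List Prog} {t t' : ℕ}

/-- Halted configurations are fixed by `step`. This makes time bounds monotone, so that branches of
different length can share one bound. -/
theorem run_eq (hc : Yields c t ν) (n : ℕ) : run (t + n) c = run t c := by
  rw [run_add]
  conv_rhs => rw [← PMF.bind_pure (run t c)]
  ext x
  simp only [PMF.bind_apply]
  refine tsum_congr fun y => ?_
  by_cases hy : y ∈ (run t c).support
  · obtain ⟨l, s⟩ := y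
    have : l = [] := hc.1 _ hy
    subst this
    rw [run_nil]
  · rw [PMF.mem_support_iff, not_not] at hy
    simp [hy]

theorem mono (hc : Yields c t ν) (h : t ≤ t') : Yields c t' ν := by
  obtain ⟨n, rfl⟩ := Nat.exists_eq_add_of_le h
  unfold Yields
  rw [hc.run_eq]
  exact hc

theorem halted (h : PMF.pure (fun i : Fin k => s.nmem 1 i) = ν) : Yields ([], s) t ν := by
  refine ⟨?_, ?_⟩
  · simp [run_nil]
  · rw [run_nil, PMF.pure_map, ← h]
    rfl

theorem of_step (h : step c = PMF.pure c') (hc : Yields c' t ν) : Yields c (t + 1) ν := by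
  have : run (t + 1) c = run t c' := by rw [run, h, PMF.pure_bind]
  unfold Yields
  rw [this]
  exact hc

/-- One time bound must serve all outcomes, while the output laws mix. Nothing is asked outside the
support of `ρ`, so the range of a uniform draw is available when array accesses are verified. -/
theorem of_random {ρ : PMF ℕ} {f : ℕ → Config} {g : ℕ → PMF (Fin k → ℕ)}
    (h : step c = ρ.map f) (hf : ∀ v ∈ ρ.support, Yields (f v) t (g v)) :
    Yields c (t + 1) (ρ.bind g) := by
  have hr : run (t + 1) c = ρ.bind fun v => run t (f v) := by
    rw [run, h, PMF.bind_map]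
    rfl
  refine ⟨?_, ?_⟩
  · intro c' hc'
    rw [hr, PMF.mem_support_bind_iff] at hc'
    obtain ⟨v, hv, hc'⟩ := hc'
    exact (hf v hv).1 c' hc'
  · rw [hr, PMF.map_bind]
    ext x
    simp only [PMF.bind_apply]
    refine tsum_congr fun v => ?_
    by_cases hv : v ∈ ρ.support
    · rw [(hf v hv).2]
    · rw [PMF.mem_support_iff, not_not] at hv
      simp [hv]

theorem natSet {x : ℕ} {e : NExpr} (h : Yields (K, s.setN x (e.eval s)) t ν) :
    Yields (.instr (.natSet x e) :: K, s) (t + 1) ν :=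
  of_step (by simp [step, Instr.exec, PMF.pure_map]) h

theorem realSet {x : ℕ} {e : RExpr} (h : Yields (K, s.setR x (e.eval s)) t ν) :
    Yields (.instr (.realSet x e) :: K, s) (t + 1) ν :=
  of_step (by simp [step, Instr.exec, PMF.pure_map]) h

theorem floor {x : ℕ} {e : RExpr} (h : Yields (K, s.setN x ⌊e.eval s⌋₊) t ν) :
    Yields (.instr (.floor x e) :: K, s) (t + 1) ν :=
  of_step (by simp [step, Instr.exec, PMF.pure_map]) h

theorem natLoad {x a : ℕ} {e : NExpr}
    (h : Yields (K, (s.setN x (s.nmem a (e.eval s))).touch (Sum.inl (a, e.eval s))) t ν) :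
    Yields (.instr (.natLoad x a e) :: K, s) (t + 1) ν :=
  of_step (by simp [step, Instr.exec, PMF.pure_map]) h

theorem natStore {a : ℕ} {e v : NExpr}
    (h : Yields (K, (s.writeN a (e.eval s) (v.eval s)).touch (Sum.inl (a, e.eval s))) t ν) :
    Yields (.instr (.natStore a e v) :: K, s) (t + 1) ν :=
  of_step (by simp [step, Instr.exec, PMF.pure_map]) h

theorem uniform {x : ℕ} {e : NExpr} {g : ℕ → PMF (Fin k → ℕ)}
    (h : ∀ v ∈ (uniformBelow (e.eval s)).support, Yields (K, s.setN x v) t (g v)) :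
    Yields (.instr (.uniform x e) :: K, s) (t + 1) ((uniformBelow (e.eval s)).bind g) :=
  of_random (f := fun v => (K, s.setN x v))
    (by simp [step, Instr.exec, PMF.map_comp, Function.comp_def]) h

theorem coin {x : ℕ} {p : RExpr} {g : ℕ → PMF (Fin k → ℕ)}
    (h : ∀ v, Yields (K, s.setN x v) t (g v)) :
    Yields (.instr (.coin x p) :: K, s) (t + 1) ((coinFlip (p.eval s)).bind g) :=
  of_random (f := fun v => (K, s.setN x v))
    (by simp [step, Instr.exec, PMF.map_comp, Function.comp_def]) fun v _ => h v

theorem seq {p q : Prog} (h : Yields (p :: q :: K, s) t ν) :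
    Yields (.seq p q :: K, s) (t + 1) ν :=
  of_step (by simp [step]) h

theorem cond {b : Test} {p q : Prog} (hp : b.holds s → Yields (p :: K, s) t ν)
    (hq : ¬ b.holds s → Yields (q :: K, s) t ν) :
    Yields (.cond b p q :: K, s) (t + 1) ν := by
  by_cases hb : b.holds s
  · exact of_step (by simp [step, hb]) (hp hb)
  · exact of_step (by simp [step, hb]) (hq hb)

/-- The rule for counting loops. `I i s ν` says that `s` is a possible store before iteration `i`
and that `ν` is the law of the output to be produced from there. -/
theorem loop {b : Test} {p : Prog} {n T : ℕ} (I : ℕ → Store → PMF (Fin k → ℕ) → Prop)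
    (body : ∀ i < n, ∀ s ν, I i s ν → b.holds s ∧ ∀ K t,
      (∀ s' ν', I (i + 1) s' ν' → Yields (K, s') t ν') → Yields (p :: K, s) (t + T) ν)
    (exit : ∀ s ν, I n s ν → ¬ b.holds s ∧ Yields (K, s) t ν)
    (start : I 0 s ν) : Yields (.loop b p :: K, s) (t + n * (T + 1) + 1) ν := by
  -- Induction on the number `m` of iterations left. Each costs one test and the body, and the
  -- failing test costs the final step. The body is known for arbitrary continuations, here the loop
  -- itself.
  suffices H : ∀ m i, i + m = n → ∀ s ν, I i s ν →
      Yields (.loop b p :: K, s) (t + m * (T + 1) + 1) ν from H n 0 (by omega) s ν start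
  intro m
  induction m with
  | zero =>
    intro i hi s ν hI
    obtain rfl : i = n := by omega
    obtain ⟨hb, hy⟩ := exit s ν hI
    exact (of_step (by simp [step, hb]) hy).mono (by omega)
  | succ m ih =>
    intro i hi s ν hI
    obtain ⟨hb, hy⟩ := body i (by omega) s ν hI
    have := hy (.loop b p :: K) _ (ih (i + 1) (by omega))
    exact (of_step (by simp [step, hb]) this).mono (by ring_nf; omega)

end Yields

/-! ### Space is bounded by input plus time -/

theorem card_touched_exec (s : Store) (i : Instr) :
    ∀ s' ∈ (i.exec s).support, s'.touched.card ≤ s.touched.card + 1 := by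
  intro s' hs'
  have key : ∀ c : Cell, (insert c s.touched).card ≤ s.touched.card + 1 :=
    fun c => Finset.card_insert_le c s.touched
  cases i with
  | natSet x e | realSet x e | floor x e =>
    simp only [Instr.exec, PMF.support_pure, Set.mem_singleton_iff] at hs'
    subst hs'
    simp [Store.setN, Store.setR]
  | natLoad x a e | natStore a e v | realLoad x a e | realStore a e v =>
    simp only [Instr.exec, PMF.support_pure, Set.mem_singleton_iff] at hs'
    subst hs'
    exact key _
  | uniform x e | coin x e =>
    simp only [Instr.exec, PMF.support_map, Set.mem_image] at hs'
    obtain ⟨v, -, rfl⟩ := hs'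
    simp [Store.setN]

theorem card_touched_step (c : Config) :
    ∀ c' ∈ (step c).support, c'.2.touched.card ≤ c.2.touched.card + 1 := by
  obtain ⟨l, s⟩ := c
  intro c' hc'
  match l with
  | [] =>
    simp only [step, PMF.support_pure, Set.mem_singleton_iff] at hc'
    subst hc'
    simp
  | .instr i :: K =>
    simp only [step, PMF.support_map, Set.mem_image] at hc'
    obtain ⟨s', hs', rfl⟩ := hc'
    exact card_touched_exec s i s' hs'
  | .seq p q :: K =>
    simp only [step, PMF.support_pure, Set.mem_singleton_iff] at hc'
    subst hc'
    simp
  | .cond b p q :: K | .loop b p :: K =>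
    simp only [step, PMF.support_pure, Set.mem_singleton_iff] at hc'
    subst hc'
    split <;> simp

theorem card_touched_run (n : ℕ) (c : Config) :
    ∀ c' ∈ (run n c).support, c'.2.touched.card ≤ c.2.touched.card + n := by
  induction n generalizing c with
  | zero =>
    intro c' hc'
    simp only [run, PMF.support_pure, Set.mem_singleton_iff] at hc'
    subst hc'
    simp
  | succ n ih =>
    intro c' hc'
    rw [run, PMF.mem_support_bind_iff] at hc'
    obtain ⟨c₁, h₁, h₂⟩ := hc'
    have := card_touched_step c c₁ h₁
    have := ih c₁ c' h₂
    omega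

theorem card_touched_inputStore {d : ℕ} (h : Fin d → ℕ) (k : ℕ) (ε β : ℝ) :
    (inputStore h k ε β).touched.card ≤ d :=
  Finset.card_image_le.trans (by simp)

/-! ### Order statistics and the sensitivity of the truncated loss -/

theorem one_le_threshold {d k : ℕ} (hkd : k ≤ d) {ε β : ℝ} (hε : 0 < ε) (hβ : 0 < β)
    (hβ1 : β < 1) : 1 ≤ threshold d k ε β := by
  unfold threshold
  rw [Nat.one_le_ceil_iff]
  have h1 : (1 : ℝ) ≤ (d.choose k : ℝ) * (k.factorial : ℝ) := by
    exact_mod_cast Nat.mul_pos (Nat.choose_pos hkd) k.factorial_pos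
  have h2 : 1 < (d.choose k : ℝ) * (k.factorial : ℝ) / β := by
    rw [lt_div_iff₀ hβ]
    linarith
  have := Real.log_pos h2
  positivity

/-- Sorting permutes the entries, so it preserves the number of those that are at least `x`, and in
decreasing order they form an initial segment. Facts about order statistics thereby become counting.
-/
theorem le_ithLargest_iff {d : ℕ} (h : Fin d → ℕ) (i : Fin d) (x : ℕ) :
    x ≤ ithLargest h i ↔ (i : ℕ) < (Finset.univ.filter fun j => x ≤ h j).card := by
  have hm : Antitone (fun i : Fin d => ithLargest h i) := fun a b hab =>
    Tuple.monotone_sort h (Fin.rev_le_rev.2 hab)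
  have hc : (Finset.univ.filter fun j => x ≤ h j).card =
      (Finset.univ.filter fun j => x ≤ ithLargest h j).card := by
    refine (Finset.card_bij' (fun j _ => Tuple.sort h j.rev)
      (fun j _ => ((Tuple.sort h).symm j).rev) ?_ ?_ ?_ ?_).symm
    · intro a ha
      rw [Finset.mem_filter] at ha ⊢
      exact ⟨Finset.mem_univ _, ha.2⟩
    · intro a ha
      rw [Finset.mem_filter] at ha ⊢
      refine ⟨Finset.mem_univ _, ?_⟩
      rw [ithLargest, Fin.rev_rev, Equiv.apply_symm_apply]
      exact ha.2
    · intro a ha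
      simp
    · intro a ha
      simp
  rw [hc]
  constructor
  · intro hx
    have : Finset.Iic i ⊆ Finset.univ.filter fun j => x ≤ ithLargest h j := by
      intro j hj
      simpa using hx.trans (hm (Finset.mem_Iic.1 hj))
    have := Finset.card_le_card this
    rw [Fin.card_Iic] at this
    omega
  · intro hx
    by_contra hlt
    have : (Finset.univ.filter fun j => x ≤ ithLargest h j) ⊆ Finset.Iio i := by
      intro j hj
      rw [Finset.mem_Iio]
      by_contra hij
      exact hlt ((Finset.mem_filter.1 hj).2.trans (hm (not_lt.1 hij)))
    have := Finset.card_le_card this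
    rw [Fin.card_Iio] at this
    omega

theorem ithLargest_le_add {d : ℕ} {h h' : Fin d → ℕ} {c : ℕ} (hh : ∀ j, h j ≤ h' j + c)
    (i : Fin d) : ithLargest h i ≤ ithLargest h' i + c := by
  have h1 := (le_ithLargest_iff h i _).1 le_rfl
  suffices ithLargest h i - c ≤ ithLargest h' i by omega
  rw [le_ithLargest_iff]
  refine h1.trans_le (Finset.card_le_card fun j hj => ?_)
  simp only [Finset.mem_filter, Finset.mem_univ, true_and] at hj ⊢
  have := hh j
  omega

theorem le_ithLargest_zero {d : ℕ} (h : Fin d → ℕ) (hd : 0 < d) (j : Fin d) :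
    h j ≤ ithLargest h ⟨0, hd⟩ := by
  rw [le_ithLargest_iff]
  exact Finset.card_pos.2 ⟨j, by simp⟩

theorem jointLoss_le_iff {d k : ℕ} (hk : 1 ≤ k) (hkd : k ≤ d) (h : Fin d → ℕ)
    (s : Fin k ↪ Fin d) (r : ℝ) : jointLoss hkd h s ≤ r ↔
    ∀ i : Fin k, ((ithLargest h (Fin.castLE hkd i) : ℝ) - (h (s i) : ℝ)) ≤ r := by
  have : Nonempty (Fin k) := ⟨⟨0, hk⟩⟩
  exact ciSup_le_iff (Set.finite_range _).bddAbove

theorem jointLoss_nonneg {d k : ℕ} (hk : 1 ≤ k) (hkd : k ≤ d) (h : Fin d → ℕ)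
    (s : Fin k ↪ Fin d) : 0 ≤ jointLoss hkd h s := by
  have h1 := (jointLoss_le_iff hk hkd h s _).1 le_rfl ⟨0, hk⟩
  have h2 : (h (s ⟨0, hk⟩) : ℝ) ≤ ithLargest h (Fin.castLE hkd ⟨0, hk⟩) := by
    exact_mod_cast le_ithLargest_zero h (by omega) _
  linarith

/-- Both terms of each difference move in the same direction: if votes are added, neither decreases
and neither grows by more than 1. So their changes do not add up to 2. -/
theorem jointLoss_le_add_one {d k : ℕ} (hk : 1 ≤ k) (hkd : k ≤ d) {h h' : Fin d → ℕ}
    (hn : Neighbor h h') (s : Fin k ↪ Fin d) :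
    jointLoss hkd h s ≤ jointLoss hkd h' s + 1 := by
  rw [jointLoss_le_iff hk]
  intro i
  have h1 := (jointLoss_le_iff hk hkd h' s _).1 le_rfl i
  suffices (ithLargest h (Fin.castLE hkd i) : ℝ) + h' (s i) ≤
      ithLargest h' (Fin.castLE hkd i) + h (s i) + 1 by linarith
  have key : ithLargest h (Fin.castLE hkd i) + h' (s i) ≤
      ithLargest h' (Fin.castLE hkd i) + h (s i) + 1 := by
    obtain ⟨V, hV | hV⟩ := hn
    · have h2 := ithLargest_le_add (h := h) (h' := h') (c := 0)
        (fun j => by rw [hV j]; omega) (Fin.castLE hkd i)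
      have h3 := hV (s i)
      split_ifs at h3 <;> omega
    · have h2 := ithLargest_le_add (h := h) (h' := h') (c := 1)
        (fun j => by rw [hV j]; split_ifs <;> omega) (Fin.castLE hkd i)
      have h3 := hV (s i)
      omega
  exact_mod_cast key

theorem truncLoss_le_add_one {d k : ℕ} (hk : 1 ≤ k) (hkd : k ≤ d) (τ : ℕ) {h h' : Fin d → ℕ}
    (hn : Neighbor h h') (s : Fin k ↪ Fin d) :
    truncLoss hkd τ h s ≤ truncLoss hkd τ h' s + 1 := by
  have := jointLoss_le_add_one hk hkd hn s
  unfold truncLoss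
  rw [← min_add_add_right]
  exact min_le_min this (by linarith)

theorem Neighbor.symm {d : ℕ} {h h' : Fin d → ℕ} (hn : Neighbor h h') : Neighbor h' h := by
  obtain ⟨V, hV⟩ := hn
  exact ⟨V, hV.symm⟩

theorem abs_truncLoss_sub_le {d k : ℕ} (hk : 1 ≤ k) (hkd : k ≤ d) (τ : ℕ) {h h' : Fin d → ℕ}
    (hn : Neighbor h h') (s : Fin k ↪ Fin d) :
    |truncLoss hkd τ h s - truncLoss hkd τ h' s| ≤ 1 := by
  have h1 := truncLoss_le_add_one hk hkd τ hn s
  have h2 := truncLoss_le_add_one hk hkd τ hn.symm s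
  rw [abs_le]
  constructor <;> linarith

theorem sensitivity_truncLoss {d k τ : ℕ} (hk : 1 ≤ k) (hkd : k ≤ d) (hτ : 1 ≤ τ)
    (hd : 2 ≤ d) : sensitivity Neighbor (truncLoss (k := k) hkd τ) = 1 := by
  have hub : ∀ r ∈ {r : ℝ | ∃ (x x' : Fin d → ℕ) (y : Fin k ↪ Fin d), Neighbor x x' ∧
      r = |truncLoss hkd τ x y - truncLoss hkd τ x' y|}, r ≤ 1 := by
    rintro r ⟨x, x', y, hn, rfl⟩
    exact abs_truncLoss_sub_le hk hkd τ hn y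
  refine le_antisymm (Real.sSup_le hub zero_le_one) ?_
  -- The value 1 is attained by the empty histogram and a single vote for item 1, with a sequence
  -- that starts with item 0. Truncation does not interfere because `τ ≥ 1`.
  let i₁ : Fin d := ⟨1, hd⟩
  let h' : Fin d → ℕ := fun i => if i ∈ ({i₁} : Finset (Fin d)) then 1 else 0
  let s : Fin k ↪ Fin d := Fin.castLEEmb hkd
  have h0 : truncLoss hkd τ (fun _ => 0) s = 0 := by
    have h1 : jointLoss hkd (fun _ => 0) s = 0 :=
      le_antisymm ((jointLoss_le_iff hk hkd _ s 0).2 fun i => by simp [ithLargest])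
        (jointLoss_nonneg hk hkd _ s)
    simp [truncLoss, h1]
  have h1 : 1 ≤ truncLoss hkd τ h' s := by
    refine le_min ?_ (by exact_mod_cast hτ)
    have h2 := (jointLoss_le_iff hk hkd h' s _).1 le_rfl ⟨0, hk⟩
    have h3 : (1 : ℝ) ≤ ithLargest h' (Fin.castLE hkd ⟨0, hk⟩) := by
      have h3 := le_ithLargest_zero h' (by omega) i₁
      have h4 : h' i₁ = 1 := by simp [h']
      rw [h4] at h3
      exact_mod_cast h3
    have h4 : h' (s ⟨0, hk⟩) = 0 := by
      simp [h', s, i₁, Fin.ext_iff]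
    rw [h4] at h2
    simp only [Nat.cast_zero, sub_zero] at h2
    exact h3.trans h2
  have hmem : |truncLoss hkd τ (fun _ => 0) s - truncLoss hkd τ h' s| ≤
      sensitivity Neighbor (truncLoss (k := k) hkd τ) :=
    le_csSup ⟨1, hub⟩ ⟨_, _, s, ⟨{i₁}, Or.inl fun i => by simp [h']⟩, rfl⟩
  rw [h0, zero_sub, abs_neg] at hmem
  exact h1.trans ((le_abs_self _).trans hmem)

/-- The weights of the mechanism, including the degenerate case `d = 1`. -/
theorem expWeight_truncLoss {d k τ : ℕ} (hk : 1 ≤ k) (hkd : k ≤ d) (hτ : 1 ≤ τ) (ε : ℝ)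
    (h : Fin d → ℕ) (s : Fin k ↪ Fin d) :
    expWeight Neighbor (truncLoss hkd τ) ε h s =
      ENNReal.ofReal (Real.exp (-(ε * truncLoss hkd τ h s / 2))) := by
  unfold expWeight
  rcases Nat.lt_or_ge 1 d with hd | hd
  · rw [sensitivity_truncLoss hk hkd hτ hd, mul_one]
  -- For `d = 1` every loss is 0, so the exponent vanishes whatever stands in the denominator.
  · obtain rfl : d = 1 := by omega
    have h1 : jointLoss hkd h s = 0 :=
      le_antisymm ((jointLoss_le_iff hk hkd _ s 0).2 fun i => by
        rw [ithLargest, Subsingleton.elim (Tuple.sort h _) (s i), sub_self])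
        (jointLoss_nonneg hk hkd _ s)
    simp [truncLoss, h1]

/-! ### Privacy and utility -/

theorem topKMechanism_apply {d k : ℕ} (hk : 1 ≤ k) (hkd : k ≤ d) {ε β : ℝ} (hε : 0 < ε)
    (hβ : 0 < β) (hβ1 : β < 1) (h : Fin d → ℕ) (s : Fin k ↪ Fin d) :
    topKMechanism hkd ε β h s =
      ENNReal.ofReal (Real.exp (-(ε * truncLoss hkd (threshold d k ε β) h s / 2))) *
      (∑ s' : Fin k ↪ Fin d,
        ENNReal.ofReal (Real.exp (-(ε * truncLoss hkd (threshold d k ε β) h s' / 2))))⁻¹ := by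
  have hτ := one_le_threshold hkd hε hβ hβ1
  have : Nonempty (Fin k ↪ Fin d) := ⟨s⟩
  change expMechanism _ _ _ _ s = _
  rw [expMechanism, PMF.normalize_apply, tsum_fintype]
  simp_rw [expWeight_truncLoss hk hkd hτ]

theorem ofReal_exp_le {ε a b : ℝ} (hε : 0 < ε) (hab : b ≤ a + 1) :
    ENNReal.ofReal (Real.exp (-(ε * a / 2))) ≤
      ENNReal.ofReal (Real.exp (ε / 2)) * ENNReal.ofReal (Real.exp (-(ε * b / 2))) := by
  rw [← ENNReal.ofReal_mul (Real.exp_nonneg _), ← Real.exp_add]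
  refine ENNReal.ofReal_le_ofReal (Real.exp_le_exp.2 ?_)
  nlinarith

/-- The weight of a sequence and the normalizer each change by a factor of at most `exp (ε / 2)`.
The bound holds pointwise and is summed over `Z`. -/
theorem isDP_topKMechanism {d k : ℕ} (hk : 1 ≤ k) (hkd : k ≤ d) {ε β : ℝ} (hε : 0 < ε)
    (hβ : 0 < β) (hβ1 : β < 1) :
    IsDP (Neighbor (d := d)) (topKMechanism (k := k) hkd ε β) ε 0 := by
  intro h h' hn Z
  rw [ENNReal.ofReal_zero, add_zero, PMF.toOuterMeasure_apply, PMF.toOuterMeasure_apply,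
    ← ENNReal.tsum_mul_left]
  refine ENNReal.tsum_le_tsum fun s => ?_
  by_cases hs : s ∈ Z
  swap
  · simp [hs]
  rw [Set.indicator_of_mem hs, Set.indicator_of_mem hs, topKMechanism_apply hk hkd hε hβ hβ1,
    topKMechanism_apply hk hkd hε hβ hβ1]
  set τ := threshold d k ε β
  set w : (Fin d → ℕ) → (Fin k ↪ Fin d) → ℝ≥0∞ := fun h s =>
    ENNReal.ofReal (Real.exp (-(ε * truncLoss hkd τ h s / 2))) with hw
  change w h s * (∑ s', w h s')⁻¹ ≤ ENNReal.ofReal (Real.exp ε) * (w h' s * (∑ s', w h' s')⁻¹)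
  set e := ENNReal.ofReal (Real.exp (ε / 2)) with he
  have hee : ENNReal.ofReal (Real.exp ε) = e * e := by
    rw [he, ← ENNReal.ofReal_mul (Real.exp_nonneg _), ← Real.exp_add, add_halves]
  have he0 : e ≠ 0 := by simp [he, Real.exp_pos]
  have het : e ≠ ∞ := ENNReal.ofReal_ne_top
  have h1 : w h s ≤ e * w h' s := ofReal_exp_le hε (truncLoss_le_add_one hk hkd τ hn.symm s)
  have h2 : ∑ s', w h' s' ≤ e * ∑ s', w h s' := by
    rw [Finset.mul_sum]
    exact Finset.sum_le_sum fun s' _ => ofReal_exp_le hε (truncLoss_le_add_one hk hkd τ hn s')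
  have h3 : (∑ s', w h s')⁻¹ ≤ e * (∑ s', w h' s')⁻¹ := by
    have := ENNReal.inv_le_inv.2 h2
    rw [ENNReal.mul_inv (Or.inl he0) (Or.inl het)] at this
    calc (∑ s', w h s')⁻¹ = e * (e⁻¹ * (∑ s', w h s')⁻¹) := by
          rw [← mul_assoc, ENNReal.mul_inv_cancel he0 het, one_mul]
      _ ≤ _ := by gcongr
  calc w h s * (∑ s', w h s')⁻¹ ≤ (e * w h' s) * (e * (∑ s', w h' s')⁻¹) := by gcongr
    _ = _ := by rw [hee]; ring

/-- There are `D` sequences. One of loss 0 makes the normalizer at least 1, so each of loss at least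
`τ` has probability at most `exp (-(ε * τ / 2)) ≤ β / D`. -/
theorem topKMechanism_tail_le {d k : ℕ} (hk : 1 ≤ k) (hkd : k ≤ d) {ε β : ℝ} (hε : 0 < ε)
    (hβ : 0 < β) (hβ1 : β < 1) (h : Fin d → ℕ) :
    (topKMechanism (k := k) hkd ε β h).toOuterMeasure
      {s | (threshold d k ε β : ℝ) ≤ jointLoss hkd h s} ≤ ENNReal.ofReal β := by
  set τ := threshold d k ε β with hτd
  set D : ℝ := (d.choose k : ℝ) * (k.factorial : ℝ) with hD
  have hD1 : 0 < D := by
    have : 0 < d.choose k * k.factorial := Nat.mul_pos (Nat.choose_pos hkd) k.factorial_pos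
    rw [hD]
    exact_mod_cast this
  have hcard : (Fintype.card (Fin k ↪ Fin d) : ℝ) = D := by
    rw [Fintype.card_embedding_eq, Fintype.card_fin, Fintype.card_fin,
      Nat.descFactorial_eq_factorial_mul_choose, hD]
    push_cast
    ring
  have hZ : 1 ≤ ∑ s' : Fin k ↪ Fin d,
      ENNReal.ofReal (Real.exp (-(ε * truncLoss hkd τ h s' / 2))) := by
    let s₀ : Fin k ↪ Fin d :=
      ⟨fun i => Tuple.sort h (Fin.castLE hkd i).rev, fun i j hij => by simpa using hij⟩
    have h0 : jointLoss hkd h s₀ = 0 :=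
      le_antisymm ((jointLoss_le_iff hk hkd _ s₀ 0).2 fun i => (sub_self _).le)
        (jointLoss_nonneg hk hkd _ s₀)
    calc (1 : ℝ≥0∞) = ENNReal.ofReal (Real.exp (-(ε * truncLoss hkd τ h s₀ / 2))) := by
          simp [truncLoss, h0]
      _ ≤ _ := Finset.single_le_sum (f := fun s' =>
          ENNReal.ofReal (Real.exp (-(ε * truncLoss hkd τ h s' / 2)))) (fun _ _ => zero_le)
          (Finset.mem_univ s₀)
  have htail : Real.exp (-(ε * τ / 2)) ≤ β / D := by
    have h1 : 2 / ε * Real.log (D / β) ≤ τ := Nat.le_ceil _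
    have h2 : Real.log (D / β) ≤ ε * τ / 2 := by
      rw [div_mul_eq_mul_div, div_le_iff₀ hε] at h1
      linarith
    calc Real.exp (-(ε * τ / 2)) ≤ Real.exp (-Real.log (D / β)) :=
          Real.exp_le_exp.2 (neg_le_neg h2)
      _ = β / D := by
          rw [Real.exp_neg, Real.exp_log (by positivity), inv_div]
  have hpt : ∀ s : Fin k ↪ Fin d,
      ({s | (τ : ℝ) ≤ jointLoss hkd h s} : Set _).indicator (topKMechanism (k := k) hkd ε β h) s ≤
        ENNReal.ofReal (β / D) := by
    intro s
    by_cases hs : s ∈ {s | (τ : ℝ) ≤ jointLoss hkd h s}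
    · rw [Set.indicator_of_mem hs, topKMechanism_apply hk hkd hε hβ hβ1]
      have h1 : truncLoss hkd τ h s = τ := min_eq_right hs
      rw [← hτd, h1]
      calc _ ≤ ENNReal.ofReal (Real.exp (-(ε * τ / 2))) * 1⁻¹ := by gcongr
        _ ≤ _ := by
          rw [inv_one, mul_one]
          exact ENNReal.ofReal_le_ofReal htail
    · rw [Set.indicator_of_notMem hs]
      exact zero_le
  rw [PMF.toOuterMeasure_apply, tsum_fintype]
  calc _ ≤ ∑ _s : Fin k ↪ Fin d, ENNReal.ofReal (β / D) := Finset.sum_le_sum fun s _ => hpt s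
    _ = ENNReal.ofReal β := by
      rw [Finset.sum_const, Finset.card_univ, ← ENNReal.ofReal_nsmul, nsmul_eq_mul, hcard,
        mul_div_cancel₀ _ hD1.ne']

/-! ### The histogram packed into one integer -/

theorem floor_exp_mul_log (B e : ℕ) (hB : 0 < B) :
    ⌊Real.exp ((e : ℝ) * Real.log (B : ℝ))⌋₊ = B ^ e := by
  have : Real.exp ((e : ℝ) * Real.log (B : ℝ)) = ((B ^ e : ℕ) : ℝ) := by
    rw [Real.exp_nat_mul, Real.exp_log (by exact_mod_cast hB)]
    push_cast
    rfl
  rw [this, Nat.floor_natCast]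

theorem floor_log_div_log {B m n : ℕ} (h₁ : B ^ m ≤ n) (h₂ : n < B ^ (m + 1)) :
    ⌊Real.log (n : ℝ) / Real.log (B : ℝ)⌋₊ = m := by
  rw [Real.log_div_log, Real.natFloor_logb_natCast]
  exact Nat.log_eq_of_pow_le_of_lt_pow h₁ h₂

/-- The sort key of an item: its number of votes, with ties broken by index. -/
def key {d : ℕ} (h : Fin d → ℕ) (j : Fin d) : ℕ := h j * d + j

/-- The histogram packed into a single natural number. -/
def packed {d : ℕ} (h : Fin d → ℕ) : ℕ := ∑ j, (d + 2) ^ key h j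

/-- The number of items with at least `x` votes. -/
def countGE {d : ℕ} (h : Fin d → ℕ) (x : ℕ) : ℕ := (Finset.univ.filter fun j => x ≤ h j).card

theorem key_div {d : ℕ} (h : Fin d → ℕ) (j : Fin d) : key h j / d = h j := by
  rw [key, mul_comm, Nat.mul_add_div j.pos, Nat.div_eq_of_lt j.2, add_zero]

theorem key_mod {d : ℕ} (h : Fin d → ℕ) (j : Fin d) : key h j % d = j := by
  rw [key, mul_comm, Nat.mul_add_mod, Nat.mod_eq_of_lt j.2]

theorem key_injective {d : ℕ} (h : Fin d → ℕ) : Function.Injective (key h) := fun a b hab => by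
  have := key_mod h a
  rw [hab, key_mod] at this
  exact Fin.ext this.symm

/-- Distinct keys give a base `d + 2` expansion with digits 0 and 1, so nothing carries. -/
theorem sum_pow_key_lt {d : ℕ} (h : Fin d → ℕ) (s : Finset (Fin d)) (n : ℕ)
    (hn : ∀ j ∈ s, key h j < n) : ∑ j ∈ s, (d + 2) ^ key h j < (d + 2) ^ n := by
  rw [← Finset.sum_image (f := fun e => (d + 2) ^ e) (key_injective h).injOn]
  refine Nat.geomSum_lt (by omega) fun e he => ?_
  obtain ⟨j, hj, rfl⟩ := Finset.mem_image.1 he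
  exact hn j hj

theorem countGE_le {d : ℕ} (h : Fin d → ℕ) (x : ℕ) : countGE h x ≤ d :=
  (Finset.card_le_univ _).trans_eq (Fintype.card_fin d)

theorem countGE_zero {d : ℕ} (h : Fin d → ℕ) : countGE h 0 = d := by simp [countGE]

theorem countGE_antitone {d : ℕ} (h : Fin d → ℕ) : Antitone (countGE h) := fun _ _ hab =>
  Finset.card_le_card (Finset.monotone_filter_right _ fun _ _ hj => le_trans hab hj)

/-- As `j < d`, a key is at least `x * d` iff its item has at least `x` votes. The division
therefore drops exactly the digits of the other items. Since `d + 2` is 1 modulo `d + 1`, the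
remainder is the sum of the digits left, and this sum is at most `d`. -/
theorem packed_div_mod {d : ℕ} (h : Fin d → ℕ) (x : ℕ) :
    packed h / (d + 2) ^ (x * d) % (d + 1) = countGE h x := by
  set e := x * d with he
  set Q := ∑ j ∈ Finset.univ.filter (fun j => x ≤ h j), (d + 2) ^ (key h j - e) with hQ
  set R := ∑ j ∈ Finset.univ.filter (fun j => ¬ x ≤ h j), (d + 2) ^ key h j with hR
  have h1 : packed h = (d + 2) ^ e * Q + R := by
    rw [packed, ← Finset.sum_filter_add_sum_filter_not _ (fun j => x ≤ h j), hQ, Finset.mul_sum]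
    congr 1
    refine Finset.sum_congr rfl fun j hj => ?_
    rw [← pow_add]
    have h2 : x * d ≤ h j * d := Nat.mul_le_mul_right d (Finset.mem_filter.1 hj).2
    congr 1
    unfold key
    omega
  have h2 : R < (d + 2) ^ e := by
    refine sum_pow_key_lt h _ e fun j hj => ?_
    have h3 : h j + 1 ≤ x := by
      have := (Finset.mem_filter.1 hj).2
      omega
    have h4 := Nat.mul_le_mul_right d h3
    rw [add_mul, one_mul] at h4
    have := j.2
    unfold key
    omega
  rw [h1, Nat.mul_add_div (by positivity), Nat.div_eq_of_lt h2, add_zero]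
  have h3 : Q ≡ countGE h x [MOD d + 1] := by
    rw [← ZMod.natCast_eq_natCast_iff, hQ]
    have h4 : ((d : ZMod (d + 1)) + 2) = 1 := by
      have : ((d + 1 : ℕ) : ZMod (d + 1)) = 0 := ZMod.natCast_self _
      push_cast at this
      calc (d : ZMod (d + 1)) + 2 = (d + 1) + 1 := by ring
        _ = 1 := by rw [this, zero_add]
    push_cast
    simp [h4, countGE]
  rw [h3, Nat.mod_eq_of_lt (Nat.lt_succ_of_le (countGE_le h x))]

theorem le_packed {d : ℕ} (h : Fin d → ℕ) (j : Fin d) : h j ≤ packed h := by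
  have hd := j.pos
  calc h j ≤ h j * d := Nat.le_mul_of_pos_right _ hd
    _ ≤ key h j := Nat.le_add_right _ _
    _ ≤ (d + 2) ^ key h j := (Nat.lt_pow_self (by omega)).le
    _ ≤ packed h := Finset.single_le_sum (f := fun j => (d + 2) ^ key h j)
        (fun _ _ => Nat.zero_le _) (Finset.mem_univ j)

/-- The items in decreasing order of their keys. -/
def ranking {d : ℕ} (h : Fin d → ℕ) : Equiv.Perm (Fin d) :=
  Fin.revPerm.trans (Tuple.sort (key h))

theorem key_ranking_lt {d : ℕ} (h : Fin d → ℕ) {i j : Fin d} (hij : i < j) :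
    key h (ranking h j) < key h (ranking h i) := by
  refine lt_of_le_of_ne (Tuple.monotone_sort (key h) (Fin.rev_le_rev.2 hij.le)) fun he => ?_
  exact hij.ne' ((ranking h).injective (key_injective h he))

/-- Both orders rearrange `h` monotonically, and the sorted values are unique. How either sort
breaks ties is irrelevant. -/
theorem ithLargest_eq {d : ℕ} (h : Fin d → ℕ) (i : Fin d) :
    ithLargest h i = h (ranking h i) := by
  have hm : Monotone (h ∘ Tuple.sort (key h)) := fun a b hab => by
    have h1 := Nat.div_le_div_right (c := d) (Tuple.monotone_sort (key h) hab)
    simpa only [Function.comp_apply, key_div] using h1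
  exact congrFun (Tuple.unique_monotone (Tuple.monotone_sort h) hm) i.rev

theorem ithLargest_antitone {d : ℕ} (h : Fin d → ℕ) : Antitone (ithLargest h) := fun _ _ hab =>
  Tuple.monotone_sort h (Fin.rev_le_rev.2 hab)

/-- What is left of `packed h` when the `i` largest keys have been removed. -/
def packedTail {d : ℕ} (h : Fin d → ℕ) (i : ℕ) : ℕ :=
  ∑ j ∈ Finset.univ.filter (fun j : Fin d => i ≤ j), (d + 2) ^ key h (ranking h j)

theorem packedTail_zero {d : ℕ} (h : Fin d → ℕ) : packedTail h 0 = packed h := by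
  simp [packedTail, packed, Equiv.sum_comp (ranking h) fun j => (d + 2) ^ key h j]

theorem packedTail_eq_add {d : ℕ} (h : Fin d → ℕ) (i : Fin d) :
    packedTail h i = (d + 2) ^ key h (ranking h i) + packedTail h (i + 1) := by
  have : Finset.univ.filter (fun j : Fin d => (i : ℕ) ≤ j) =
      insert i (Finset.univ.filter fun j : Fin d => (i : ℕ) + 1 ≤ j) := by
    ext j
    simp only [Finset.mem_filter, Finset.mem_univ, true_and, Finset.mem_insert, Fin.ext_iff]
    omega
  rw [packedTail, this, Finset.sum_insert (by simp), packedTail]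

/-- The leading digit of the tail sits at the largest remaining key. Reading and removing it
repeatedly sorts the items in linear time. -/
theorem floor_log_packedTail {d : ℕ} (h : Fin d → ℕ) (i : Fin d) :
    ⌊Real.log (packedTail h i : ℝ) / Real.log ((d + 2 : ℕ) : ℝ)⌋₊ = key h (ranking h i) := by
  refine floor_log_div_log (by rw [packedTail_eq_add]; exact Nat.le_add_right _ _) ?_
  have hs : packedTail h i = ∑ j ∈ (Finset.univ.filter fun j : Fin d => (i : ℕ) ≤ j).map
      (ranking h).toEmbedding, (d + 2) ^ key h j := by
    rw [Finset.sum_map]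
    rfl
  rw [hs]
  refine sum_pow_key_lt h _ _ fun j hj => ?_
  obtain ⟨a, ha, rfl⟩ := Finset.mem_map.1 hj
  have ha : i ≤ a := (Finset.mem_filter.1 ha).2
  rcases ha.eq_or_lt with rfl | hlt
  · exact Nat.lt_succ_self _
  · exact Nat.lt_succ_of_lt (key_ranking_lt h hlt)

/-! ### Fisher–Yates shuffles confined to prefixes -/

theorem uniformBelow_apply {n v : ℕ} (hv : v < n) : uniformBelow n v = (n : ℝ≥0∞)⁻¹ := by
  have hn : 0 < n := by omega
  rw [uniformBelow, dif_pos hn, PMF.uniformOfFinset_apply_of_mem _ (Finset.mem_range.2 hv),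
    Finset.card_range]

theorem lt_of_mem_support_uniformBelow {n v : ℕ} (hn : 0 < n)
    (hv : v ∈ (uniformBelow n).support) : v < n := by
  rw [uniformBelow, dif_pos hn, PMF.mem_support_uniformOfFinset_iff, Finset.mem_range] at hv
  exact hv

theorem coinFlip_bind_apply {α : Type*} {p : ℝ} (hp0 : 0 ≤ p) (hp1 : p ≤ 1) (g : ℕ → PMF α)
    (x : α) : (coinFlip p).bind g x =
      ENNReal.ofReal p * g 1 x + ENNReal.ofReal (1 - p) * g 0 x := by
  have hmin : min p.toNNReal 1 = p.toNNReal := min_eq_left (by simpa using hp1)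
  rw [coinFlip, PMF.bind_map, PMF.bind_apply, tsum_bool]
  rw [add_comm]
  change ((min p.toNNReal 1 : ℝ≥0) : ℝ≥0∞) * g 1 x +
    ((1 - min p.toNNReal 1 : ℝ≥0) : ℝ≥0∞) * g 0 x = _
  rw [hmin]
  congr 2
  rw [ENNReal.ofReal_sub _ hp0, ENNReal.ofReal_one]
  simp [ENNReal.ofReal]

/-- The law of the first `k` entries of the array `A` after `n` steps, started at position `i`,
of a Fisher–Yates shuffle that swaps position `i` with a random position in `[i, c i)`. -/
noncomputable def shuffleLaw (k : ℕ) (c : ℕ → ℕ) : ℕ → ℕ → (ℕ → ℕ) → PMF (Fin k → ℕ)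
  | 0, _, A => PMF.pure fun j => A j
  | n + 1, i, A => (uniformBelow (c i - i)).bind fun u =>
      shuffleLaw k c n (i + 1) (A ∘ Equiv.swap i (i + u))

theorem swap_lt_iff {i j n : ℕ} (hi : i < n) (hj : j < n) (a : ℕ) :
    Equiv.swap i j a < n ↔ a < n := by
  rw [Equiv.swap_apply_def]
  split_ifs <;> omega

theorem injOn_comp_swap {A : ℕ → ℕ} {d i j : ℕ} (hA : Set.InjOn A (Set.Iio d)) (hi : i < d)
    (hj : j < d) : Set.InjOn (A ∘ Equiv.swap i j) (Set.Iio d) := fun a ha b hb hab =>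
  (Equiv.swap i j).injective (hA ((swap_lt_iff hi hj a).2 ha) ((swap_lt_iff hi hj b).2 hb) hab)

-- The set `S j` of the first `c j` entries is invariant: a swap at step `i` stays below `c i`,
-- hence below `c j` for `j ≥ i`. So for a given `f` exactly one of the `c i - i` draws puts `f i`
-- in place, and every admissible `f` has the same probability.
open Classical in
theorem shuffleLaw_apply {d k : ℕ} {c : ℕ → ℕ} (S : ℕ → Set ℕ)
    (hc : ∀ j < k, j < c j ∧ c j ≤ d) (hm : ∀ i j, i ≤ j → j < k → c i ≤ c j)
    {f : Fin k → ℕ} (hf : Function.Injective f) (n i : ℕ) (hn : i + n = k) (A : ℕ → ℕ)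
    (hA : Set.InjOn A (Set.Iio d))
    (hS : ∀ j, i ≤ j → j < k → ∀ x, x ∈ S j ↔ ∃ m < c j, A m = x) :
    shuffleLaw k c n i A f =
      if (∀ j : Fin k, (j : ℕ) < i → A j = f j) ∧ (∀ j : Fin k, i ≤ j → f j ∈ S j)
      then ∏ j ∈ Finset.Ico i k, ((c j - j : ℕ) : ℝ≥0∞)⁻¹ else 0 := by
  induction n generalizing i A with
  | zero =>
    obtain rfl : i = k := by omega
    rw [shuffleLaw, PMF.pure_apply, Finset.Ico_self, Finset.prod_empty]
    have hiff : (f = fun j : Fin i => A j) ↔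
        (∀ j : Fin i, (j : ℕ) < i → A j = f j) ∧ ∀ j : Fin i, i ≤ j → f j ∈ S j := by
      constructor
      · rintro rfl
        exact ⟨fun j _ => rfl, fun j hj => absurd j.2 (not_lt.2 hj)⟩
      · rintro ⟨h1, -⟩
        funext j
        exact (h1 j j.2).symm
    simp only [hiff]
  | succ n ih =>
    have hik : i < k := by omega
    obtain ⟨hic, hcd⟩ := hc i hik
    have hS' : ∀ u < c i - i, ∀ j, i + 1 ≤ j → j < k → ∀ x, x ∈ S j ↔
        ∃ m < c j, (A ∘ Equiv.swap i (i + u)) m = x := by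
      intro u hu j hij hjk x
      have hcc := hm i j (by omega) hjk
      rw [hS j (by omega) hjk]
      constructor
      · rintro ⟨m, hmc, rfl⟩
        exact ⟨Equiv.swap i (i + u) m, (swap_lt_iff (by omega) (by omega) m).2 hmc, by simp⟩
      · rintro ⟨m, hmc, rfl⟩
        exact ⟨Equiv.swap i (i + u) m, (swap_lt_iff (by omega) (by omega) m).2 hmc, rfl⟩
    have hrec : ∀ u < c i - i, shuffleLaw k c n (i + 1) (A ∘ Equiv.swap i (i + u)) f =
        if (∀ j : Fin k, (j : ℕ) < i + 1 → (A ∘ Equiv.swap i (i + u)) j = f j) ∧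
          (∀ j : Fin k, i + 1 ≤ j → f j ∈ S j)
        then ∏ j ∈ Finset.Ico (i + 1) k, ((c j - j : ℕ) : ℝ≥0∞)⁻¹ else 0 := fun u hu =>
      ih (i + 1) (by omega) _ (injOn_comp_swap hA (by omega) (by omega)) (hS' u hu)
    have hlow : ∀ u, ∀ j : Fin k, (j : ℕ) < i → (A ∘ Equiv.swap i (i + u)) j = A j := by
      intro u j hj
      rw [Function.comp_apply, Equiv.swap_apply_of_ne_of_ne (by omega) (by omega)]
    have hat : ∀ u, (A ∘ Equiv.swap i (i + u)) i = A (i + u) := by simp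
    rw [shuffleLaw, PMF.bind_apply]
    split_ifs with hcond
    · obtain ⟨h1, h2⟩ := hcond
      obtain ⟨m, hmc, hmf⟩ := (hS i le_rfl hik _).1 (h2 ⟨i, hik⟩ le_rfl)
      -- Positions below `i` already hold earlier values of `f`, which differ from `f i` by
      -- injectivity.
      have him : i ≤ m := by
        by_contra hlt
        have h3 := h1 ⟨m, by omega⟩ (by simpa using hlt)
        have h4 := hf (h3.symm.trans hmf)
        have := congrArg Fin.val h4
        simp only at this
        omega
      obtain ⟨u, rfl⟩ := Nat.exists_eq_add_of_le him
      have hu : u < c i - i := by omega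
      rw [tsum_eq_single u]
      · rw [uniformBelow_apply hu, hrec u hu, if_pos, Finset.prod_eq_prod_Ico_succ_bot hik]
        refine ⟨fun j hj => ?_, fun j hj => h2 j (by omega)⟩
        rcases Nat.lt_succ_iff_lt_or_eq.1 hj with hj | hj
        · rw [hlow u j hj, h1 j hj]
        · obtain rfl : j = ⟨i, hik⟩ := Fin.ext hj
          exact (hat u).trans hmf
      · intro v hv
        by_cases hvc : v ∈ (uniformBelow (c i - i)).support
        · have hvc := lt_of_mem_support_uniformBelow (by omega) hvc
          rw [hrec v hvc, if_neg, mul_zero]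
          rintro ⟨h3, -⟩
          have h4 := h3 ⟨i, hik⟩ (Nat.lt_succ_self i)
          have h5 : A (i + v) = A (i + u) := (hat v).symm.trans (h4.trans hmf.symm)
          have := hA (Set.mem_Iio.2 (by omega)) (Set.mem_Iio.2 (by omega)) h5
          omega
        · rw [PMF.mem_support_iff, not_not] at hvc
          rw [hvc, zero_mul]
    · rw [ENNReal.tsum_eq_zero]
      intro v
      by_cases hvc : v ∈ (uniformBelow (c i - i)).support
      · have hvc := lt_of_mem_support_uniformBelow (by omega) hvc
        rw [hrec v hvc, if_neg, mul_zero]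
        rintro ⟨h3, h4⟩
        refine hcond ⟨fun j hj => ?_, fun j hj => ?_⟩
        · rw [← hlow v j hj]
          exact h3 j (by omega)
        · rcases hj.eq_or_lt with hj | hj
          · obtain rfl : j = ⟨i, hik⟩ := Fin.ext hj.symm
            rw [hS i le_rfl hik]
            exact ⟨i + v, by omega, (hat v).symm.trans (h3 ⟨i, hik⟩ (Nat.lt_succ_self i))⟩
          · exact h4 j hj
      · rw [PMF.mem_support_iff, not_not] at hvc
        rw [hvc, zero_mul]

theorem mem_support_shuffleLaw {d k : ℕ} {c : ℕ → ℕ} (hkd : k ≤ d)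
    (hc : ∀ j < k, j < c j ∧ c j ≤ d) (n i : ℕ) (hn : i + n = k) (A : ℕ → ℕ)
    (hA : Set.InjOn A (Set.Iio d)) (hAd : ∀ j < d, A j < d) (g : Fin k → ℕ)
    (hg : g ∈ (shuffleLaw k c n i A).support) :
    g ∈ Set.range fun (s : Fin k ↪ Fin d) (j : Fin k) => (s j : ℕ) := by
  induction n generalizing i A with
  | zero =>
    rw [shuffleLaw, PMF.support_pure, Set.mem_singleton_iff] at hg
    subst hg
    refine ⟨⟨fun j => ⟨A j, hAd j (by omega)⟩, fun a b hab => ?_⟩, rfl⟩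
    have h1 : A a = A b := congrArg Fin.val hab
    exact Fin.ext (hA (Set.mem_Iio.2 (by omega)) (Set.mem_Iio.2 (by omega)) h1)
  | succ n ih =>
    obtain ⟨hic, hcd⟩ := hc i (by omega)
    rw [shuffleLaw, PMF.mem_support_bind_iff] at hg
    obtain ⟨u, hu, hg⟩ := hg
    have hu := lt_of_mem_support_uniformBelow (by omega) hu
    exact ih (i + 1) (by omega) _ (injOn_comp_swap hA (by omega) (by omega))
      (fun j hj => hAd _ ((swap_lt_iff (by omega) (by omega) j).2 hj)) hg

/-! ### Weighted reservoir sampling -/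

/-- The law `F R` for a level `R` that is chosen by weighted reservoir sampling: `R` is the current
choice, `W` the total weight seen so far, and level `r` of weight `a r` is the next of the `n`
levels still to come. -/
noncomputable def reservoirLaw {α : Type*} (a : ℕ → ℝ) (F : ℕ → PMF α) : ℕ → ℕ → ℝ → ℕ → PMF α
  | 0, _, _, R => F R
  | n + 1, r, W, R => (coinFlip (a r / (W + a r))).bind fun b =>
      reservoirLaw a F n (r + 1) (W + a r) (if 0 < b then r else R)

/-- After the next level the total is `W + a r`, so the coin leaves weight `a r` on that level and
`W` on the old choice. Multiplying by the total weight avoids quotients in the induction. -/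
theorem reservoirLaw_apply_mul {α : Type*} {a : ℕ → ℝ} (ha : ∀ r, 0 ≤ a r) (F : ℕ → PMF α)
    (x : α) (n r : ℕ) {W : ℝ} (hW : 0 < W) (R : ℕ) :
    reservoirLaw a F n r W R x * ENNReal.ofReal (W + ∑ j ∈ Finset.Ico r (r + n), a j) =
      ENNReal.ofReal W * F R x +
        ∑ j ∈ Finset.Ico r (r + n), ENNReal.ofReal (a j) * F j x := by
  induction n generalizing r W R with
  | zero => simp [reservoirLaw, mul_comm]
  | succ n ih =>
    have hr := ha r
    have hW' : 0 < W + a r := by linarith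
    have hp0 : 0 ≤ a r / (W + a r) := by positivity
    have hp1 : a r / (W + a r) ≤ 1 := by
      rw [div_le_one hW']
      linarith
    have hsplit : ∀ {M : Type} [AddCommMonoid M] (f : ℕ → M),
        ∑ j ∈ Finset.Ico r (r + (n + 1)), f j =
          f r + ∑ j ∈ Finset.Ico (r + 1) (r + 1 + n), f j := by
      intro M _ f
      rw [Finset.sum_eq_sum_Ico_succ_bot (by omega)]
      congr 3
      omega
    have h1 := ih (r + 1) hW' r
    have h0 := ih (r + 1) hW' R
    have e1 : ENNReal.ofReal (a r / (W + a r)) * ENNReal.ofReal (W + a r) =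
        ENNReal.ofReal (a r) := by
      rw [← ENNReal.ofReal_mul hp0, div_mul_cancel₀ _ hW'.ne']
    have e0 : ENNReal.ofReal (1 - a r / (W + a r)) * ENNReal.ofReal (W + a r) =
        ENNReal.ofReal W := by
      rw [← ENNReal.ofReal_mul (by linarith), sub_mul, div_mul_cancel₀ _ hW'.ne']
      congr 1
      ring
    -- The later levels contribute the same for both outcomes of the coin, so the two probabilities
    -- add up to 1 there.
    have e2 : ENNReal.ofReal (a r / (W + a r)) + ENNReal.ofReal (1 - a r / (W + a r)) = 1 := by
      rw [← ENNReal.ofReal_add hp0 (by linarith)]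
      simp
    rw [reservoirLaw, coinFlip_bind_apply hp0 hp1, hsplit, hsplit, ← add_assoc W, add_mul,
      mul_assoc, mul_assoc]
    simp only [zero_lt_one, lt_self_iff_false, if_true, if_false]
    rw [h1, h0, mul_add, mul_add, ← mul_assoc, ← mul_assoc, e1, e0]
    calc _ = ENNReal.ofReal W * F R x + (ENNReal.ofReal (a r) * F r x +
          (ENNReal.ofReal (a r / (W + a r)) + ENNReal.ofReal (1 - a r / (W + a r))) *
          ∑ j ∈ Finset.Ico (r + 1) (r + 1 + n), ENNReal.ofReal (a j) * F j x) := by ring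
      _ = _ := by rw [e2, one_mul]

theorem mem_support_reservoirLaw {α : Type*} {a : ℕ → ℝ} {F : ℕ → PMF α} {T : Set α}
    (hF : ∀ R, (F R).support ⊆ T) (n r : ℕ) (W : ℝ) (R : ℕ) :
    (reservoirLaw a F n r W R).support ⊆ T := by
  induction n generalizing r W R with
  | zero => exact hF R
  | succ n ih =>
    intro x hx
    rw [reservoirLaw, PMF.mem_support_bind_iff] at hx
    obtain ⟨b, -, hx⟩ := hx
    exact ih _ _ _ hx

/-- A law on `β` that is proportional to `w` along `ι` and supported in the range of `ι` is the
image of the normalization of `w`. -/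
theorem eq_map_of_apply_mul_eq {α β : Type*} [Fintype α] {ι : α → β} (hι : Function.Injective ι)
    {p : PMF β} {μ : PMF α} {w : α → ℝ≥0∞} {Z : ℝ≥0∞} (hZ : Z ≠ 0) (hZt : Z ≠ ∞)
    (hp : ∀ a, p (ι a) * Z = w a) (hs : p.support ⊆ Set.range ι)
    (hμ : ∀ a, μ a = w a * (∑ a', w a')⁻¹) : p = μ.map ι := by
  -- The constant `Z` must be the normalizer, because `p` has total mass 1 on the range of `ι`.
  have hsum : ∑ a, w a = Z := by
    have h1 : ∑' a, p (ι a) = 1 := by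
      rw [hι.tsum_eq hs, p.tsum_coe]
    rw [tsum_fintype] at h1
    rw [← Finset.sum_congr rfl fun a _ => hp a, ← Finset.sum_mul, h1, one_mul]
  ext b
  by_cases hb : b ∈ Set.range ι
  · obtain ⟨a, rfl⟩ := hb
    rw [PMF.map_apply, tsum_eq_single a, if_pos rfl, hμ, hsum, ← hp, mul_assoc,
      ENNReal.mul_inv_cancel hZ hZt, mul_one]
    intro a' ha'
    exact if_neg fun h => ha' (hι h).symm
  · have h1 : p b = 0 := by
      by_contra h
      exact hb (hs h)
    have h2 : (μ.map ι) b = 0 := by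
      by_contra h
      have : b ∈ (μ.map ι).support := h
      rw [PMF.support_map] at this
      obtain ⟨a, -, rfl⟩ := this
      exact hb ⟨a, rfl⟩
    rw [h1, h2]

/-! ### Level sets of the loss and the mixture -/

/-- The items of `h` by decreasing number of votes, as an array. -/
def sortedItems {d : ℕ} (h : Fin d → ℕ) (j : ℕ) : ℕ :=
  if hj : j < d then ranking h ⟨j, hj⟩ else 0

/-- The entries of `h` in decreasing order, as an array. -/
def sortedVals {d : ℕ} (h : Fin d → ℕ) (j : ℕ) : ℕ :=
  if hj : j < d then ithLargest h ⟨j, hj⟩ else 0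

/-- The number of items that a sequence of loss at most `R` may have at position `j`. -/
def levelCount {d : ℕ} (h : Fin d → ℕ) (R j : ℕ) : ℕ := countGE h (sortedVals h j - R)

/-- The uniform law on the sequences of loss at most `R`. -/
noncomputable def levelLaw {d : ℕ} (h : Fin d → ℕ) (k R : ℕ) : PMF (Fin k → ℕ) :=
  shuffleLaw k (levelCount h R) k 0 (sortedItems h)

noncomputable def decay (ε : ℝ) (r : ℕ) : ℝ := Real.exp (-(ε * r / 2))

/-- The number of sequences of loss at most `R`. -/
def levelSize {d : ℕ} (h : Fin d → ℕ) (k R : ℕ) : ℕ :=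
  ∏ j ∈ Finset.range k, (levelCount h R j - j)

/-- The factor `levelSize` compensates for the normalization of the uniform law: each sequence of
the level receives exactly the drop of the decay. -/
noncomputable def levelWeight {d : ℕ} (h : Fin d → ℕ) (k : ℕ) (ε : ℝ) (r : ℕ) : ℝ :=
  (decay ε r - decay ε (r + 1)) * (levelSize h k r : ℝ)

/-- The law of the output of the program: the level of truncation is `packed h`, which exceeds
every loss. -/
noncomputable def targetLaw {d : ℕ} (h : Fin d → ℕ) (k : ℕ) (ε : ℝ) (τ : ℕ) :
    PMF (Fin k → ℕ) :=
  reservoirLaw (levelWeight h k ε) (levelLaw h k) τ 0 (decay ε τ * (d.descFactorial k : ℝ))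
    (packed h)

section

variable {d : ℕ} (h : Fin d → ℕ)

theorem sortedItems_fin (j : Fin d) : sortedItems h j = ranking h j := by simp [sortedItems]

theorem sortedVals_fin (j : Fin d) : sortedVals h j = ithLargest h j := by simp [sortedVals]

theorem injOn_sortedItems : Set.InjOn (sortedItems h) (Set.Iio d) := by
  intro a ha b hb hab
  rw [Set.mem_Iio] at ha hb
  rw [sortedItems, sortedItems, dif_pos ha, dif_pos hb] at hab
  have := (ranking h).injective (Fin.ext hab)
  simpa using this

theorem sortedItems_lt {j : ℕ} (hj : j < d) : sortedItems h j < d := by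
  rw [sortedItems, dif_pos hj]
  exact Fin.is_lt _

theorem sortedVals_le_packed (j : ℕ) : sortedVals h j ≤ packed h := by
  unfold sortedVals
  split_ifs
  · exact le_packed h _
  · exact Nat.zero_le _

/-- The `j + 1` first items of the sorted order always qualify, so no position runs out of choices.
-/
theorem levelCount_spec (R : ℕ) {j : ℕ} (hj : j < d) :
    j < levelCount h R j ∧ levelCount h R j ≤ d := by
  refine ⟨?_, countGE_le h _⟩
  refine (le_ithLargest_iff h ⟨j, hj⟩ _).1 ?_
  rw [sortedVals, dif_pos hj]
  exact Nat.sub_le _ _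

theorem levelCount_mono (R : ℕ) {i j : ℕ} (hij : i ≤ j) (hj : j < d) :
    levelCount h R i ≤ levelCount h R j := by
  refine countGE_antitone h (Nat.sub_le_sub_right ?_ R)
  rw [sortedVals, sortedVals, dif_pos hj, dif_pos (hij.trans_lt hj)]
  exact ithLargest_antitone h (by simpa using hij)

theorem levelCount_packed (j : ℕ) : levelCount h (packed h) j = d := by
  rw [levelCount, Nat.sub_eq_zero_of_le (sortedVals_le_packed h j), countGE_zero]

theorem exists_sortedItems_eq_iff (y x : ℕ) :
    (∃ m < countGE h y, sortedItems h m = x) ↔ ∃ hx : x < d, y ≤ h ⟨x, hx⟩ := by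
  have key : ∀ m : Fin d, (m : ℕ) < countGE h y ↔ y ≤ h (ranking h m) := fun m => by
    rw [← ithLargest_eq h, le_ithLargest_iff]
    rfl
  constructor
  · rintro ⟨m, hm, rfl⟩
    have hmd : m < d := hm.trans_le (countGE_le h y)
    refine ⟨sortedItems_lt h hmd, ?_⟩
    have := (key ⟨m, hmd⟩).1 hm
    simpa only [sortedItems, dif_pos hmd, Fin.eta] using this
  · rintro ⟨hx, hy⟩
    refine ⟨(ranking h).symm ⟨x, hx⟩, (key _).2 ?_, ?_⟩
    · rwa [Equiv.apply_symm_apply]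
    · rw [sortedItems_fin, Equiv.apply_symm_apply]

end

-- The bound on the loss is a separate condition on each `s j`, namely membership in a prefix of the
-- sorted items. This is the situation of `shuffleLaw_apply`.
open Classical in
theorem levelLaw_apply {d k : ℕ} (hkd : k ≤ d) (h : Fin d → ℕ) (R : ℕ) (s : Fin k ↪ Fin d) :
    levelLaw h k R (fun j => (s j : ℕ)) =
      if ∀ j : Fin k, ithLargest h (Fin.castLE hkd j) ≤ h (s j) + R
      then ((levelSize h k R : ℕ) : ℝ≥0∞)⁻¹ else 0 := by
  have hprod : ∏ j ∈ Finset.Ico 0 k, ((levelCount h R j - j : ℕ) : ℝ≥0∞)⁻¹ =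
      ((levelSize h k R : ℕ) : ℝ≥0∞)⁻¹ := by
    rw [← Finset.range_eq_Ico, levelSize, Nat.cast_prod, ENNReal.prod_inv_distrib]
    intro i _ j _ _
    exact Or.inr (ENNReal.natCast_ne_top _)
  rw [levelLaw, shuffleLaw_apply (fun j => {x | ∃ hx : x < d, sortedVals h j - R ≤ h ⟨x, hx⟩})
    (fun j hj => levelCount_spec h R (hj.trans_le hkd))
    (fun i j hij hj => levelCount_mono h R hij (hj.trans_le hkd))
    (fun a b hab => s.injective (Fin.ext hab)) k 0 (by omega) _ (injOn_sortedItems h)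
    (fun j _ _ x => (exists_sortedItems_eq_iff h _ x).symm), hprod]
  congr 1
  rw [eq_iff_iff]
  have key : ∀ j : Fin k, sortedVals h j = ithLargest h (Fin.castLE hkd j) := fun j =>
    sortedVals_fin h (Fin.castLE hkd j)
  constructor
  · rintro ⟨-, h2⟩ j
    obtain ⟨hx, hy⟩ := h2 j (Nat.zero_le _)
    rw [key] at hy
    simp only [Fin.eta] at hy
    omega
  · intro h2
    refine ⟨fun j hj => absurd hj (Nat.not_lt_zero _), fun j _ => ⟨(s j).2, ?_⟩⟩
    have := h2 j
    rw [key]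
    simp only [Fin.eta]
    omega

theorem support_levelLaw_subset {d k : ℕ} (hkd : k ≤ d) (h : Fin d → ℕ) (R : ℕ) : (levelLaw h k R).support ⊆
    Set.range fun (s : Fin k ↪ Fin d) (j : Fin k) => (s j : ℕ) := fun g hg =>
  mem_support_shuffleLaw hkd (fun _ hj => levelCount_spec h R (hj.trans_le hkd)) k 0 (by omega) _
    (injOn_sortedItems h) (fun _ hj => sortedItems_lt h hj) g hg

theorem decay_antitone {ε : ℝ} (hε : 0 < ε) (r : ℕ) : decay ε (r + 1) ≤ decay ε r := by
  refine Real.exp_le_exp.2 ?_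
  push_cast
  nlinarith

theorem levelSize_pos {d k : ℕ} (hkd : k ≤ d) (h : Fin d → ℕ) (R : ℕ) :
    0 < levelSize h k R :=
  Finset.prod_pos fun j hj => by
    have := (levelCount_spec h R ((Finset.mem_range.1 hj).trans_le hkd)).1
    omega

theorem levelSize_packed {d : ℕ} (h : Fin d → ℕ) (k : ℕ) :
    levelSize h k (packed h) = d.descFactorial k := by
  simp_rw [levelSize, levelCount_packed, Nat.descFactorial_eq_prod_range]

/-- The maximum is attained at an integer difference and is nonnegative, so the truncated
subtraction of naturals is exact there. -/
theorem exists_jointLoss_eq {d k : ℕ} (hk : 1 ≤ k) (hkd : k ≤ d) (h : Fin d → ℕ)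
    (s : Fin k ↪ Fin d) : ∃ l : ℕ, jointLoss hkd h s = l ∧
      ∀ R : ℕ, (∀ j : Fin k, ithLargest h (Fin.castLE hkd j) ≤ h (s j) + R) ↔ l ≤ R := by
  have : Nonempty (Fin k) := ⟨⟨0, hk⟩⟩
  obtain ⟨i, hi⟩ := exists_eq_ciSup_of_finite
    (f := fun i : Fin k => ((ithLargest h (Fin.castLE hkd i) : ℝ) - (h (s i) : ℝ)))
  change _ = jointLoss hkd h s at hi
  have h0 := jointLoss_nonneg hk hkd h s
  rw [← hi, sub_nonneg, Nat.cast_le] at h0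
  have hl : jointLoss hkd h s = ((ithLargest h (Fin.castLE hkd i) - h (s i) : ℕ) : ℝ) := by
    rw [← hi, Nat.cast_sub h0]
  refine ⟨_, hl, fun R => ?_⟩
  rw [← Nat.cast_le (α := ℝ), ← hl, jointLoss_le_iff hk]
  refine forall_congr' fun j => ?_
  rw [sub_le_iff_le_add']
  exact_mod_cast Iff.rfl

/-- The sum telescopes from `l` to `τ`, and is empty if `τ ≤ l`. -/
theorem sum_ite_sub_add_eq (e : ℕ → ℝ) (l τ : ℕ) :
    (∑ r ∈ Finset.range τ, if l ≤ r then e r - e (r + 1) else 0) + e τ = e (min l τ) := by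
  induction τ with
  | zero => simp
  | succ τ ih =>
    rw [Finset.sum_range_succ]
    by_cases hl : l ≤ τ
    · rw [min_eq_left hl] at ih
      rw [min_eq_left (by omega), if_pos hl]
      linarith
    · rw [min_eq_right (by omega), if_neg hl, Finset.sum_eq_zero fun r hr => if_neg ?_]
      · ring
      · have := Finset.mem_range.1 hr
        omega

/-- The law of the output of the program is that of the exponential mechanism. -/
theorem targetLaw_eq {d k : ℕ} (hk : 1 ≤ k) (hkd : k ≤ d) {ε β : ℝ} (hε : 0 < ε)
    (hβ : 0 < β) (hβ1 : β < 1) (h : Fin d → ℕ) :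
    targetLaw h k ε (threshold d k ε β) =
      (topKMechanism (k := k) hkd ε β h).map fun s i => (s i : ℕ) := by
  classical
  set τ := threshold d k ε β with hτ
  set D : ℕ := d.descFactorial k with hD
  have hD0 : 0 < D := Nat.descFactorial_pos.2 hkd
  have hW : 0 < decay ε τ * (D : ℝ) := mul_pos (Real.exp_pos _) (by exact_mod_cast hD0)
  have ha : ∀ r, 0 ≤ levelWeight h k ε r := fun r =>
    mul_nonneg (sub_nonneg.2 (decay_antitone hε r)) (Nat.cast_nonneg _)
  have hcancel : ∀ {x : ℝ} {n : ℕ}, 0 ≤ x → 0 < n →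
      ENNReal.ofReal (x * n) * (n : ℝ≥0∞)⁻¹ = ENNReal.ofReal x := by
    intro x n hx hn
    rw [ENNReal.ofReal_mul hx, ENNReal.ofReal_natCast, mul_assoc, ENNReal.mul_inv_cancel
      (by exact_mod_cast hn.ne') (ENNReal.natCast_ne_top n), mul_one]
  refine eq_map_of_apply_mul_eq (fun s s' hs => ?_)
    (Z := ENNReal.ofReal (decay ε τ * D + ∑ j ∈ Finset.Ico 0 (0 + τ), levelWeight h k ε j))
    ?_ ENNReal.ofReal_ne_top
    (w := fun s => ENNReal.ofReal (Real.exp (-(ε * truncLoss hkd τ h s / 2)))) (fun s => ?_)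
    (mem_support_reservoirLaw (fun R => support_levelLaw_subset hkd h R) _ _ _ _)
    (topKMechanism_apply hk hkd hε hβ hβ1 h)
  · ext j
    exact congrFun hs j
  · rw [Ne, ENNReal.ofReal_eq_zero, not_le]
    exact add_pos_of_pos_of_nonneg hW (Finset.sum_nonneg fun j _ => ha j)
  · obtain ⟨l, hl, hlR⟩ := exists_jointLoss_eq hk hkd h s
    -- The initial reservoir level `packed h` excludes no sequence. With initial weight `decay ε τ *
    -- D` it contributes `decay ε τ` to each.
    have hlp : l ≤ packed h := (hlR _).1 fun j => (le_packed h _).trans (Nat.le_add_left _ _)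
    change reservoirLaw _ _ _ _ _ _ _ * _ = _
    rw [reservoirLaw_apply_mul ha _ _ _ _ hW]
    simp_rw [levelLaw_apply hkd h, hlR]
    rw [if_pos hlp, levelSize_packed, ← hD, hcancel (x := decay ε τ) (Real.exp_nonneg _) hD0]
    have hterm : ∀ r, ENNReal.ofReal (levelWeight h k ε r) *
        (if l ≤ r then ((levelSize h k r : ℕ) : ℝ≥0∞)⁻¹ else 0) =
        ENNReal.ofReal (if l ≤ r then decay ε r - decay ε (r + 1) else 0) := by
      intro r
      split_ifs
      · rw [levelWeight, hcancel (sub_nonneg.2 (decay_antitone hε r)) (levelSize_pos hkd h r)]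
      · simp
    have hnn : ∀ r, 0 ≤ if l ≤ r then decay ε r - decay ε (r + 1) else 0 := by
      intro r
      split_ifs
      · exact sub_nonneg.2 (decay_antitone hε r)
      · exact le_rfl
    simp_rw [hterm]
    rw [← ENNReal.ofReal_sum_of_nonneg fun r _ => hnn r,
      ← ENNReal.ofReal_add (p := decay ε τ) (Real.exp_nonneg _) (Finset.sum_nonneg fun r _ => hnn r), add_comm,
      zero_add, ← Finset.range_eq_Ico, sum_ite_sub_add_eq, decay]
    congr 4
    rw [truncLoss, hl, Nat.cast_min]

/-! ### The program

Natural-number registers: `0` is `d`, `1` is `k`, `2` is the packed histogram, `3` is a counter,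
`4` is `d.descFactorial k`, `5` is the threshold, `9` and `10` are the current and the chosen
level, and the others are temporary. Array `1` holds the items, array `2` the sorted entries. -/

/-- Put `(d + 2) ^ e` into register `7`. -/
def powProg (e : NExpr) : Prog :=
  .instr (.floor 7 (.exp (.mul (.cast e) (.log (.cast (.add (.reg 0) (.const 2)))))))

/-- Increment the counter. -/
def incrProg : Prog := .instr (.natSet 3 (.add (.reg 3) (.const 1)))

/-- The number of sequences is a descending factorial, found by `k` multiplications. The machine
only rounds down, so the ceiling is the floor corrected by a test; the self-assignment is a no-op.
-/
def thresholdProg : Prog :=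
  .seq (.instr (.natSet 4 (.const 1))) <|
  .seq (.instr (.natSet 3 (.const 0))) <|
  .seq (.loop (.natLT (.reg 3) (.reg 1)) <|
    .seq (.instr (.natSet 4 (.mul (.reg 4) (.sub (.reg 0) (.reg 3))))) incrProg) <|
  .seq (.instr (.realSet 2 (.mul (.div (.cast (.const 2)) (.reg 0))
    (.log (.div (.cast (.reg 4)) (.reg 1)))))) <|
  .seq (.instr (.floor 5 (.reg 2))) <|
  .cond (.realLT (.cast (.reg 5)) (.reg 2))
    (.instr (.natSet 5 (.add (.reg 5) (.const 1)))) (.instr (.natSet 5 (.reg 5)))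

def packProg : Prog :=
  .seq (.instr (.natSet 2 (.const 0))) <|
  .seq (.instr (.natSet 3 (.const 0))) <|
  .loop (.natLT (.reg 3) (.reg 0)) <|
    .seq (.instr (.natLoad 6 0 (.reg 3))) <|
    .seq (powProg (.add (.mul (.reg 6) (.reg 0)) (.reg 3))) <|
    .seq (.instr (.natSet 2 (.add (.reg 2) (.reg 7)))) incrProg

/-- Register `8` holds the tail of the packed histogram. The leading exponent is a key, whose
remainder modulo `d` is the item and whose quotient by `d` is its number of votes. -/
def sortProg : Prog :=
  .seq (.instr (.natSet 8 (.reg 2))) <|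
  .seq (.instr (.natSet 3 (.const 0))) <|
  .loop (.natLT (.reg 3) (.reg 0)) <|
    .seq (.instr (.floor 6 (.div (.log (.cast (.reg 8)))
      (.log (.cast (.add (.reg 0) (.const 2))))))) <|
    .seq (.instr (.natStore 1 (.reg 3) (.mod (.reg 6) (.reg 0)))) <|
    .seq (.instr (.natStore 2 (.reg 3) (.div (.reg 6) (.reg 0)))) <|
    .seq (powProg (.reg 6)) <|
    .seq (.instr (.natSet 8 (.sub (.reg 8) (.reg 7)))) incrProg

/-- With register `6` holding the sorted entry at the current position, prepare register `7` such
that `choicesExpr` is the number of choices at this position for the level in register `R`. -/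
def levelPowProg (R : ℕ) : Prog := powProg (.mul (.sub (.reg 6) (.reg R)) (.reg 0))

def choicesExpr : NExpr :=
  .sub (.mod (.div (.reg 2) (.reg 7)) (.add (.reg 0) (.const 1))) (.reg 3)

def decayExpr (e : NExpr) : RExpr :=
  .exp (.div (.sub (.cast (.const 0)) (.mul (.reg 0) (.cast e))) (.cast (.const 2)))

/-- Put the number of sequences of the current level into register `11`. -/
def levelSizeProg : Prog :=
  .seq (.instr (.natSet 11 (.const 1))) <|
  .seq (.instr (.natSet 3 (.const 0))) <|
  .loop (.natLT (.reg 3) (.reg 1)) <|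
    .seq (.instr (.natLoad 6 2 (.reg 3))) <|
    .seq (levelPowProg 9) <|
    .seq (.instr (.natSet 11 (.mul (.reg 11) choicesExpr))) incrProg

/-- Choose the level. -/
def reservoirProg : Prog :=
  .seq (.instr (.natSet 10 (.reg 2))) <|
  .seq (.instr (.realSet 3 (.mul (decayExpr (.reg 5)) (.cast (.reg 4))))) <|
  .seq (.instr (.natSet 9 (.const 0))) <|
  .loop (.natLT (.reg 9) (.reg 5)) <|
    .seq levelSizeProg <|
    .seq (.instr (.realSet 4 (.mul (.sub (decayExpr (.reg 9))
      (decayExpr (.add (.reg 9) (.const 1)))) (.cast (.reg 11))))) <|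
    .seq (.instr (.realSet 3 (.add (.reg 3) (.reg 4)))) <|
    .seq (.instr (.coin 12 (.div (.reg 4) (.reg 3)))) <|
    .seq (.cond (.natLT (.const 0) (.reg 12)) (.instr (.natSet 10 (.reg 9)))
      (.instr (.natSet 10 (.reg 10)))) <|
    .instr (.natSet 9 (.add (.reg 9) (.const 1)))

/-- Draw a sequence of the chosen level. -/
def shuffleProg : Prog :=
  .seq (.instr (.natSet 3 (.const 0))) <|
  .loop (.natLT (.reg 3) (.reg 1)) <|
    .seq (.instr (.natLoad 6 2 (.reg 3))) <|
    .seq (levelPowProg 10) <|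
    .seq (.instr (.uniform 12 choicesExpr)) <|
    .seq (.instr (.natLoad 13 1 (.reg 3))) <|
    .seq (.instr (.natLoad 14 1 (.add (.reg 3) (.reg 12)))) <|
    .seq (.instr (.natStore 1 (.reg 3) (.reg 14))) <|
    .seq (.instr (.natStore 1 (.add (.reg 3) (.reg 12)) (.reg 13))) incrProg

def topKProg : Prog :=
  .seq thresholdProg <| .seq packProg <| .seq sortProg <| .seq reservoirProg shuffleProg

/-! ### Verification -/

/-- The registers and the input array while the program runs. -/
structure Ctx {d : ℕ} (h : Fin d → ℕ) (k : ℕ) (ε β : ℝ) (N D τ : ℕ) (s : Store) : Prop where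
  reg_d : s.nreg 0 = d
  reg_k : s.nreg 1 = k
  reg_N : s.nreg 2 = N
  reg_D : s.nreg 4 = D
  reg_τ : s.nreg 5 = τ
  reg_ε : s.rreg 0 = ε
  reg_β : s.rreg 1 = β
  hist : ∀ j : Fin d, s.nmem 0 j = h j

/-- Array `a` starts with the first `n` values of `A`. -/
def HasArray (a n : ℕ) (A : ℕ → ℕ) (s : Store) : Prop := ∀ j < n, s.nmem a j = A j

namespace Ctx

variable {d : ℕ} {h : Fin d → ℕ} {k : ℕ} {ε β : ℝ} {N D τ : ℕ} {s : Store}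

theorem setN (hs : Ctx h k ε β N D τ s) {x : ℕ} (v : ℕ)
    (hx : x ≠ 0 ∧ x ≠ 1 ∧ x ≠ 2 ∧ x ≠ 4 ∧ x ≠ 5) : Ctx h k ε β N D τ (s.setN x v) := by
  obtain ⟨h0, h1, h2, h4, h5⟩ := hx
  obtain ⟨a, b, c, e, f, g, i, j⟩ := hs
  constructor <;> simp only [Store.setN, Function.update_of_ne h0.symm,
    Function.update_of_ne h1.symm, Function.update_of_ne h2.symm, Function.update_of_ne h4.symm,
    Function.update_of_ne h5.symm] <;> assumption

theorem setR (hs : Ctx h k ε β N D τ s) {x : ℕ} (v : ℝ) (hx : x ≠ 0 ∧ x ≠ 1) :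
    Ctx h k ε β N D τ (s.setR x v) := by
  obtain ⟨h0, h1⟩ := hx
  obtain ⟨a, b, c, e, f, g, i, j⟩ := hs
  constructor <;> simp only [Store.setR, Function.update_of_ne h0.symm,
    Function.update_of_ne h1.symm] <;> assumption

theorem touch (hs : Ctx h k ε β N D τ s) (c : Cell) : Ctx h k ε β N D τ (s.touch c) := by
  obtain ⟨a, b, c, e, f, g, i, j⟩ := hs
  constructor <;> assumption

theorem writeN (hs : Ctx h k ε β N D τ s) {a : ℕ} (i v : ℕ) (ha : a ≠ 0) :
    Ctx h k ε β N D τ (s.writeN a i v) := by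
  obtain ⟨a, b, c, e, f, g, i, j⟩ := hs
  constructor <;> simp only [Store.writeN, Function.update_of_ne ha.symm] <;> assumption

theorem setN_N (hs : Ctx h k ε β N D τ s) (v : ℕ) : Ctx h k ε β v D τ (s.setN 2 v) := by
  obtain ⟨a, b, c, e, f, g, i, j⟩ := hs
  constructor <;> simp [Store.setN, *]

theorem setN_D (hs : Ctx h k ε β N D τ s) (v : ℕ) : Ctx h k ε β N v τ (s.setN 4 v) := by
  obtain ⟨a, b, c, e, f, g, i, j⟩ := hs
  constructor <;> simp [Store.setN, *]

theorem setN_τ (hs : Ctx h k ε β N D τ s) (v : ℕ) : Ctx h k ε β N D v (s.setN 5 v) := by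
  obtain ⟨a, b, c, e, f, g, i, j⟩ := hs
  constructor <;> simp [Store.setN, *]

end Ctx

theorem eval_decayExpr {s : Store} {ε : ℝ} (hε : s.rreg 0 = ε) (e : NExpr) :
    (decayExpr e).eval s = decay ε (e.eval s) := by
  simp only [decayExpr, RExpr.eval, NExpr.eval, hε, decay]
  congr 1
  push_cast
  ring

namespace Yields

variable {d k : ℕ} {h : Fin d → ℕ} {ε β : ℝ} {N D τ : ℕ} {s : Store} {K : List Prog} {t : ℕ}
  {k' : ℕ} {ν : PMF (Fin k' → ℕ)}

theorem powProg {e : NExpr} (hd : s.nreg 0 = d)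
    (hy : Yields (K, s.setN 7 ((d + 2) ^ e.eval s)) t ν) :
    Yields (powProg e :: K, s) (t + 1) ν := by
  refine floor ?_
  simp only [RExpr.eval, NExpr.eval, hd]
  rwa [floor_exp_mul_log _ _ (by omega)]

theorem thresholdProg (hs : Ctx h k ε β N D τ s)
    (hy : ∀ s', Ctx h k ε β N (d.descFactorial k) (threshold d k ε β) s' → Yields (K, s') t ν) :
    Yields (thresholdProg :: K, s) (t + (k * 4 + 20)) ν := by
  refine mono (.seq (.natSet (.seq (.natSet (.seq (.loop (n := k) (T := 3)
    (t := t + 6) (fun i s' ν' => ν' = ν ∧ Ctx h k ε β N (d.descFactorial i) τ s' ∧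
      s'.nreg 3 = i) ?_ ?_ ?_)))))) (by omega)
  · rintro i hi s' ν' ⟨rfl, hc, h3⟩
    refine ⟨by simpa [Test.holds, NExpr.eval, h3, hc.reg_k] using hi, fun K t hy => ?_⟩
    refine .seq (.natSet (.natSet (hy _ _ ⟨rfl, ?_, ?_⟩)))
    · refine Ctx.setN ?_ _ (by decide)
      have := hc.setN_D (d.descFactorial (i + 1))
      simpa only [NExpr.eval, hc.reg_d, hc.reg_D, h3, Nat.descFactorial_succ, mul_comm] using this
    · simp [Store.setN, NExpr.eval, h3]
  · rintro s' ν' ⟨rfl, hc, h3⟩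
    refine ⟨by simp [Test.holds, NExpr.eval, h3, hc.reg_k], ?_⟩
    have hx : ((2 : ℕ) : ℝ) / ε * Real.log ((d.descFactorial k : ℝ) / β) =
        2 / ε * Real.log ((d.choose k : ℝ) * (k.factorial : ℝ) / β) := by
      rw [Nat.descFactorial_eq_factorial_mul_choose]
      push_cast
      rw [mul_comm (k.factorial : ℝ)]
    set x := 2 / ε * Real.log ((d.choose k : ℝ) * (k.factorial : ℝ) / β) with hxdef
    refine .seq (.realSet (.seq (.floor ?_)))
    simp only [RExpr.eval, NExpr.eval, hc.reg_ε, hc.reg_β, hc.reg_D, hx]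
    have hc2 := hc.setR (x := 2) x (by decide)
    have hr : (s'.setR 2 x).rreg 2 = x := by simp [Store.setR]
    rw [hr]
    have hc5 := hc2.setN_τ ⌊x⌋₊
    have hr5 : ((s'.setR 2 x).setN 5 ⌊x⌋₊).rreg 2 = x := hr
    refine .cond (fun hb => ?_) fun hb => ?_
    · simp only [Test.holds, RExpr.eval, NExpr.eval, hc5.reg_τ, hr5] at hb
      refine .natSet (hy _ ?_)
      simp only [NExpr.eval, hc5.reg_τ]
      have : threshold d k ε β = ⌊x⌋₊ + 1 := by
        refine le_antisymm (Nat.ceil_le_floor_add_one x) ?_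
        rw [Nat.succ_le_iff, threshold, Nat.lt_ceil]
        exact hb
      rw [this]
      exact hc5.setN_τ _
    · simp only [Test.holds, RExpr.eval, NExpr.eval, hc5.reg_τ, hr5] at hb
      refine .natSet (hy _ ?_)
      simp only [NExpr.eval, hc5.reg_τ]
      have : threshold d k ε β = ⌊x⌋₊ :=
        le_antisymm (Nat.ceil_le.2 (not_lt.1 hb)) (Nat.floor_le_ceil x)
      rw [this]
      exact hc5.setN_τ _
  · refine ⟨rfl, Ctx.setN ?_ _ (by decide), by simp [Store.setN, NExpr.eval]⟩
    rw [Nat.descFactorial_zero]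
    exact hs.setN_D _

theorem packProg (hs : Ctx h k ε β N D τ s)
    (hy : ∀ s', Ctx h k ε β (packed h) D τ s' → Yields (K, s') t ν) :
    Yields (packProg :: K, s) (t + (d * 8 + 5)) ν := by
  let S : ℕ → ℕ := fun i => ∑ j ∈ Finset.range i,
    if hj : j < d then (d + 2) ^ key h ⟨j, hj⟩ else 0
  have hSd : S d = packed h := by
    simp only [S, Finset.sum_range, Fin.is_lt, dif_pos, Fin.eta]
    rfl
  refine mono (.seq (.natSet (.seq (.natSet (.loop (n := d) (T := 7)
    (t := t) (fun i s' ν' => ν' = ν ∧ Ctx h k ε β (S i) D τ s' ∧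
      s'.nreg 3 = i) ?_ ?_ ?_))))) (by omega)
  · rintro i hi s' ν' ⟨rfl, hc, h3⟩
    refine ⟨by simpa [Test.holds, NExpr.eval, h3, hc.reg_d] using hi, fun K t hy => ?_⟩
    refine .seq (.natLoad (.seq (.powProg (d := d)
      ((hc.setN (x := 6) _ (by decide)).touch _).reg_d
      (.seq (.natSet (.natSet (hy _ _ ⟨rfl, Ctx.setN ?_ _ (by decide), ?_⟩)))))))
    · have hkey : s'.nmem 0 i * d + i = key h ⟨i, hi⟩ := by rw [hc.hist ⟨i, hi⟩]; rfl
      have hS : S (i + 1) = S i + (d + 2) ^ key h ⟨i, hi⟩ := by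
        simp [S, Finset.sum_range_succ, hi]
      have := ((((hc.setN (x := 6) (s'.nmem 0 i) (by decide)).touch (Sum.inl (0, i))).setN
        (x := 7) ((d + 2) ^ key h ⟨i, hi⟩) (by decide))).setN_N (S (i + 1))
      simpa [NExpr.eval, Store.setN, Store.touch, hc.reg_d, hc.reg_N, h3, hkey, hS] using this
    · simp [Store.setN, Store.touch, NExpr.eval, h3]
  · rintro s' ν' ⟨rfl, hc, h3⟩
    exact ⟨by simp [Test.holds, NExpr.eval, h3, hc.reg_d], hy _ (hSd ▸ hc)⟩
  · exact ⟨rfl, (hs.setN_N _).setN _ (by decide), by simp [Store.setN, NExpr.eval]⟩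

theorem sortProg (hs : Ctx h k ε β (packed h) D τ s)
    (hy : ∀ s', Ctx h k ε β (packed h) D τ s' → HasArray 1 d (sortedItems h) s' →
      HasArray 2 d (sortedVals h) s' → Yields (K, s') t ν) :
    Yields (sortProg :: K, s) (t + (d * 12 + 5)) ν := by
  refine mono (.seq (.natSet (.seq (.natSet (.loop (n := d) (T := 11)
    (t := t) (fun i s' ν' => ν' = ν ∧ Ctx h k ε β (packed h) D τ s' ∧
      HasArray 1 i (sortedItems h) s' ∧ HasArray 2 i (sortedVals h) s' ∧
      s'.nreg 3 = i ∧ s'.nreg 8 = packedTail h i) ?_ ?_ ?_))))) (by omega)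
  · rintro i hi s' ν' ⟨rfl, hc, hA1, hA2, h3, h8⟩
    refine ⟨by simpa [Test.holds, NExpr.eval, h3, hc.reg_d] using hi, fun K t hy => ?_⟩
    refine .seq (.floor ?_)
    have hfl : ⌊((RExpr.log (.cast (.reg 8))).div
        (.log (.cast (.add (.reg 0) (.const 2))))).eval s'⌋₊ = key h (ranking h ⟨i, hi⟩) := by
      simp only [RExpr.eval, NExpr.eval, h8, hc.reg_d]
      exact floor_log_packedTail h ⟨i, hi⟩
    rw [hfl]
    have hc6 := hc.setN (x := 6) (key h (ranking h ⟨i, hi⟩)) (by decide)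
    have hmod : key h (ranking h ⟨i, hi⟩) % d = sortedItems h i := by
      rw [key_mod, sortedItems, dif_pos hi]
    have hdiv : key h (ranking h ⟨i, hi⟩) / d = sortedVals h i := by
      rw [key_div, sortedVals, dif_pos hi, ithLargest_eq]
    have htail : packedTail h i - (d + 2) ^ key h (ranking h ⟨i, hi⟩) = packedTail h (i + 1) := by
      rw [packedTail_eq_add h ⟨i, hi⟩, Nat.add_sub_cancel_left]
    refine .seq (.natStore (.seq (.natStore (.seq (.powProg (d := d) hc6.reg_d
      (.seq (.natSet (.natSet (hy _ _ ⟨rfl, ?_, ?_, ?_, ?_, ?_⟩)))))))))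
    · exact ((((((hc6.writeN _ _ (by decide)).touch _).writeN _ _ (by decide)).touch _).setN _
        (by decide)).setN _ (by decide)).setN _ (by decide)
    · intro j hj
      rcases Nat.lt_succ_iff_lt_or_eq.1 hj with hj | rfl
      · simpa [Store.setN, Store.touch, Store.writeN, NExpr.eval, h3, hj.ne] using hA1 j hj
      · simpa [Store.setN, Store.touch, Store.writeN, NExpr.eval, h3, hc.reg_d] using hmod
    · intro j hj
      rcases Nat.lt_succ_iff_lt_or_eq.1 hj with hj | rfl
      · simpa [Store.setN, Store.touch, Store.writeN, NExpr.eval, h3, hj.ne] using hA2 j hj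
      · simpa [Store.setN, Store.touch, Store.writeN, NExpr.eval, h3, hc.reg_d] using hdiv
    · simp [Store.setN, Store.touch, Store.writeN, NExpr.eval, h3]
    · simpa [Store.setN, Store.touch, Store.writeN, NExpr.eval, h8] using htail
  · rintro s' ν' ⟨rfl, hc, hA1, hA2, h3, h8⟩
    exact ⟨by simp [Test.holds, NExpr.eval, h3, hc.reg_d], hy _ hc hA1 hA2⟩
  · refine ⟨rfl, (hs.setN _ (by decide)).setN _ (by decide),
      fun j hj => absurd hj (Nat.not_lt_zero j), fun j hj => absurd hj (Nat.not_lt_zero j), ?_, ?_⟩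
    · simp [Store.setN, NExpr.eval]
    · simp [Store.setN, NExpr.eval, packedTail_zero, hs.reg_N]

end Yields

theorem eval_choicesExpr {d k : ℕ} {h : Fin d → ℕ} {ε β : ℝ} {D τ R j : ℕ} {s : Store}
    (hs : Ctx h k ε β (packed h) D τ s) (h3 : s.nreg 3 = j)
    (h7 : s.nreg 7 = (d + 2) ^ ((sortedVals h j - R) * d)) :
    choicesExpr.eval s = levelCount h R j - j := by
  simp only [choicesExpr, NExpr.eval, hs.reg_N, hs.reg_d, h3, h7, packed_div_mod, levelCount]

namespace Yields

variable {d k : ℕ} {h : Fin d → ℕ} {ε β : ℝ} {D τ : ℕ} {s : Store} {K : List Prog} {t : ℕ}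

theorem levelSizeProg {ν : PMF (Fin k → ℕ)} (hkd : k ≤ d) {r R : ℕ} {W : ℝ} {A : ℕ → ℕ}
    (hs : Ctx h k ε β (packed h) D τ s)
    (hA1 : HasArray 1 d A s) (hA2 : HasArray 2 d (sortedVals h) s) (h9 : s.nreg 9 = r)
    (h10 : s.nreg 10 = R) (hr3 : s.rreg 3 = W)
    (hy : ∀ s', Ctx h k ε β (packed h) D τ s' → HasArray 1 d A s' →
      HasArray 2 d (sortedVals h) s' → s'.nreg 9 = r → s'.nreg 10 = R → s'.rreg 3 = W →
      s'.nreg 11 = levelSize h k r → Yields (K, s') t ν) :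
    Yields (levelSizeProg :: K, s) (t + (k * 8 + 5)) ν := by
  refine mono (.seq (.natSet (.seq (.natSet (.loop (n := k) (T := 7)
    (t := t) (fun i s' ν' => ν' = ν ∧ Ctx h k ε β (packed h) D τ s' ∧
      HasArray 1 d A s' ∧ HasArray 2 d (sortedVals h) s' ∧ s'.nreg 9 = r ∧
      s'.nreg 10 = R ∧ s'.rreg 3 = W ∧ s'.nreg 3 = i ∧
      s'.nreg 11 = levelSize h i r) ?_ ?_ ?_))))) (by omega)
  · rintro i hi s' ν' ⟨rfl, hc, hA1, hA2, h9, h10, hr3, h3, h11⟩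
    refine ⟨by simpa [Test.holds, NExpr.eval, h3, hc.reg_k] using hi, fun K t hy => ?_⟩
    have hc6 := (hc.setN (x := 6) (s'.nmem 2 i) (by decide)).touch (Sum.inl (2, i))
    refine .seq (.natLoad (.seq (.powProg (d := d)
      ((hc.setN (x := 6) _ (by decide)).touch _).reg_d (.seq ?_))))
    simp only [NExpr.eval, h3]
    have hpow : (((s'.setN 6 (s'.nmem 2 i)).touch (Sum.inl (2, i))).nreg 6 -
        ((s'.setN 6 (s'.nmem 2 i)).touch (Sum.inl (2, i))).nreg 9) *
        ((s'.setN 6 (s'.nmem 2 i)).touch (Sum.inl (2, i))).nreg 0 =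
        (sortedVals h i - r) * d := by
      simp [Store.setN, Store.touch, h9, hc.reg_d, hA2 i (hi.trans_le hkd)]
    rw [hpow]
    have hc7 := hc6.setN (x := 7) ((d + 2) ^ ((sortedVals h i - r) * d)) (by decide)
    have hch := eval_choicesExpr (R := r) (j := i) hc7 (by simp [Store.setN, Store.touch, h3])
      (by simp [Store.setN])
    refine .natSet (.natSet (hy _ _ ⟨rfl, (hc7.setN _ (by decide)).setN _ (by decide), hA1, hA2,
      h9, h10, hr3, ?_, ?_⟩))
    · simp [Store.setN, Store.touch, NExpr.eval, h3]
    · simp only [NExpr.eval, hch]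
      simp [Store.setN, Store.touch, h11, levelSize, Finset.prod_range_succ]
  · rintro s' ν' ⟨rfl, hc, hA1, hA2, h9, h10, hr3, h3, h11⟩
    exact ⟨by simp [Test.holds, NExpr.eval, h3, hc.reg_k], hy _ hc hA1 hA2 h9 h10 hr3 h11⟩
  · refine ⟨rfl, (hs.setN _ (by decide)).setN _ (by decide), hA1, hA2, h9, h10, hr3, ?_, ?_⟩
    · simp [Store.setN, NExpr.eval]
    · simp [Store.setN, NExpr.eval, levelSize]

theorem reservoirProg (hkd : k ≤ d) {F : ℕ → PMF (Fin k → ℕ)}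
    (hs : Ctx h k ε β (packed h) D τ s) {A : ℕ → ℕ} (hA1 : HasArray 1 d A s)
    (hA2 : HasArray 2 d (sortedVals h) s)
    (hy : ∀ R s', Ctx h k ε β (packed h) D τ s' → HasArray 1 d A s' →
      HasArray 2 d (sortedVals h) s' → s'.nreg 10 = R → Yields (K, s') t (F R)) :
    Yields (reservoirProg :: K, s) (t + (τ * (k * 8 + 20) + 7))
      (reservoirLaw (levelWeight h k ε) F τ 0 (decay ε τ * (D : ℝ)) (packed h)) := by
  -- The law still to be produced changes with the coins: it is the reservoir law of the remaining
  -- `τ - r` levels, started from the current weight and choice.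
  refine mono (.seq (.natSet (.seq (.realSet (.seq (.natSet (.loop (n := τ) (T := k * 8 + 19)
    (t := t) (fun r s' ν' => ∃ W R, ν' = reservoirLaw (levelWeight h k ε) F (τ - r) r W R ∧
      Ctx h k ε β (packed h) D τ s' ∧ HasArray 1 d A s' ∧ HasArray 2 d (sortedVals h) s' ∧
      s'.nreg 9 = r ∧ s'.nreg 10 = R ∧ s'.rreg 3 = W) ?_ ?_ ?_))))))) (by ring_nf; omega)
  · rintro r hr s' ν' ⟨W, R, rfl, hc, hA1, hA2, h9, h10, hr3⟩
    refine ⟨by simpa [Test.holds, NExpr.eval, h9, hc.reg_τ] using hr, fun K t hy => ?_⟩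
    refine mono (.seq (.levelSizeProg (t := t + 12) hkd hc hA1 hA2 h9 h10 hr3 ?_)) (by omega)
    intro s' hc hA1 hA2 h9 h10 hr3 h11
    refine .mono (.seq (.realSet (.seq (.realSet (t := t + 8) ?_)))) (by omega)
    have hw : (RExpr.mul (.sub (decayExpr (.reg 9)) (decayExpr (.add (.reg 9) (.const 1))))
        (.cast (.reg 11))).eval s' = levelWeight h k ε r := by
      simp only [RExpr.eval, eval_decayExpr hc.reg_ε, NExpr.eval, h9, h11, levelWeight]
    rw [hw]
    have hW : (RExpr.add (.reg 3) (.reg 4)).eval (s'.setR 4 (levelWeight h k ε r)) =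
        W + levelWeight h k ε r := by
      simp [RExpr.eval, Store.setR, hr3]
    rw [hW]
    have hc' := (hc.setR (x := 4) (levelWeight h k ε r) (by decide)).setR (x := 3)
      (W + levelWeight h k ε r) (by decide)
    set s₁ := (s'.setR 4 (levelWeight h k ε r)).setR 3 (W + levelWeight h k ε r) with hs₁
    have h9₁ : s₁.nreg 9 = r := h9
    have h10₁ : s₁.nreg 10 = R := h10
    have hr3₁ : s₁.rreg 3 = W + levelWeight h k ε r := by simp [hs₁, Store.setR]
    have hr4₁ : s₁.rreg 4 = levelWeight h k ε r := by simp [hs₁, Store.setR]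
    have hA1₁ : HasArray 1 d A s₁ := hA1
    have hA2₁ : HasArray 2 d (sortedVals h) s₁ := hA2
    have hn : τ - r = τ - (r + 1) + 1 := by omega
    rw [hn, reservoirLaw]
    have hp : (RExpr.div (.reg 4) (.reg 3)).eval s₁ =
        levelWeight h k ε r / (W + levelWeight h k ε r) := by
      simp only [RExpr.eval, hr3₁, hr4₁]
    rw [← hp]
    refine .mono (.seq (.coin fun v => .seq (.cond (t := t + 2) (fun hb => ?_) fun hb => ?_)))
      (by omega : t + 6 ≤ t + 8)
    · have hv : 0 < v := by simpa [Test.holds, NExpr.eval, Store.setN] using hb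
      rw [if_pos hv]
      refine .natSet (.natSet (hy _ _ ⟨_, r, rfl, ((hc'.setN _ (by decide)).setN _
        (by decide)).setN _ (by decide), hA1₁, hA2₁, ?_, ?_, hr3₁⟩))
      · simp [Store.setN, NExpr.eval, h9₁]
      · simp [Store.setN, NExpr.eval, h9₁]
    · have hv : ¬ 0 < v := by simpa [Test.holds, NExpr.eval, Store.setN] using hb
      rw [if_neg hv]
      refine .natSet (.natSet (hy _ _ ⟨_, R, rfl, ((hc'.setN _ (by decide)).setN _
        (by decide)).setN _ (by decide), hA1₁, hA2₁, ?_, ?_, hr3₁⟩))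
      · simp [Store.setN, NExpr.eval, h9₁]
      · simp [Store.setN, NExpr.eval, h10₁]
  · rintro s' ν' ⟨W, R, rfl, hc, hA1, hA2, h9, h10, hr3⟩
    refine ⟨by simp [Test.holds, NExpr.eval, h9, hc.reg_τ], ?_⟩
    rw [Nat.sub_self, reservoirLaw]
    exact hy R _ hc hA1 hA2 h10
  · refine ⟨_, _, by rw [Nat.sub_zero], ((hs.setN _ (by decide)).setR _ (by decide)).setN _
      (by decide), hA1, hA2, ?_, ?_, ?_⟩
    · simp [Store.setN, NExpr.eval]
    · simp [Store.setN, Store.setR, NExpr.eval, hs.reg_N]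
    · have hc := hs.setN (x := 10) ((NExpr.reg 2).eval s) (by decide)
      simp only [Store.setN, Store.setR, Function.update_self]
      rw [RExpr.eval]
      exact congrArg₂ (· * ·) ((eval_decayExpr hc.reg_ε _).trans (congrArg _ hc.reg_τ))
        (congrArg Nat.cast hc.reg_D)

theorem shuffleProg (hkd : k ≤ d) {R : ℕ}
    (hs : Ctx h k ε β (packed h) D τ s) (hA1 : HasArray 1 d (sortedItems h) s)
    (hA2 : HasArray 2 d (sortedVals h) s) (h10 : s.nreg 10 = R) :
    Yields ([shuffleProg], s) (k * 17 + 5) (levelLaw h k R) := by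
  refine mono (.seq (.natSet (.loop (n := k) (T := 16)
    (t := 0) (fun i s' ν' => ∃ A, ν' = shuffleLaw k (levelCount h R) (k - i) i A ∧
      Ctx h k ε β (packed h) D τ s' ∧ HasArray 1 d A s' ∧ HasArray 2 d (sortedVals h) s' ∧
      s'.nreg 3 = i ∧ s'.nreg 10 = R) ?_ ?_ ?_))) (by omega)
  · rintro i hi s' ν' ⟨A, rfl, hc, hA1, hA2, h3, h10⟩
    refine ⟨by simpa [Test.holds, NExpr.eval, h3, hc.reg_k] using hi, fun K t hy => ?_⟩
    have hid := hi.trans_le hkd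
    have hc6 := (hc.setN (x := 6) (s'.nmem 2 i) (by decide)).touch (Sum.inl (2, i))
    refine .mono (.seq (.natLoad (.seq (.powProg (d := d)
      ((hc.setN (x := 6) _ (by decide)).touch _).reg_d
      (.seq (t := t + 10) ?_))))) (by omega)
    simp only [NExpr.eval, h3]
    have hpow : (((s'.setN 6 (s'.nmem 2 i)).touch (Sum.inl (2, i))).nreg 6 -
        ((s'.setN 6 (s'.nmem 2 i)).touch (Sum.inl (2, i))).nreg 10) *
        ((s'.setN 6 (s'.nmem 2 i)).touch (Sum.inl (2, i))).nreg 0 =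
        (sortedVals h i - R) * d := by
      simp [Store.setN, Store.touch, h10, hc.reg_d, hA2 i hid]
    rw [hpow]
    have hc7 := hc6.setN (x := 7) ((d + 2) ^ ((sortedVals h i - R) * d)) (by decide)
    have hch := eval_choicesExpr (R := R) (j := i) hc7 (by simp [Store.setN, Store.touch, h3])
      (by simp [Store.setN])
    have hn : k - i = k - (i + 1) + 1 := by omega
    rw [hn, shuffleLaw, ← hch]
    refine .mono (.uniform fun u hu => .seq (.natLoad (.seq (.natLoad (.seq (.natStore
      (.seq (.natStore (.natSet (hy _ _ ⟨_, rfl, ?_, ?_, ?_, ?_, ?_⟩)))))))))) (by omega)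
    · exact ((((((((hc7.setN _ (by decide)).setN _ (by decide)).touch _).setN _
        (by decide)).touch _).writeN _ _ (by decide)).touch _).writeN _ _ (by decide)).touch _
        |>.setN _ (by decide)
    -- The drawn position stays below `levelCount h R i ≤ d`, where the contents of the array are
    -- known.
    · rw [hch] at hu
      obtain ⟨hic, hcd⟩ := levelCount_spec h R hid
      have hu := lt_of_mem_support_uniformBelow (by omega) hu
      have hiu : i + u < d := by omega
      intro j hj
      have e1 := hA1 j hj
      have e2 := hA1 i hid
      have e3 := hA1 (i + u) hiu
      simp only [NExpr.eval, Store.setN, Store.touch, Store.writeN, Function.update_apply,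
        Function.comp_apply, Equiv.swap_apply_def, h3]
      norm_num
      split_ifs <;> simp_all [Function.update_apply]
    · exact hA2
    · simp [Store.setN, Store.touch, Store.writeN, NExpr.eval, h3]
    · simp [Store.setN, Store.touch, Store.writeN, h10]
  · rintro s' ν' ⟨A, rfl, hc, hA1, hA2, h3, h10⟩
    refine ⟨by simp [Test.holds, NExpr.eval, h3, hc.reg_k], .halted ?_⟩
    rw [Nat.sub_self, shuffleLaw]
    congr 1
    funext j
    exact hA1 j (j.2.trans_le hkd)
  · exact ⟨_, by rw [Nat.sub_zero]; rfl, hs.setN _ (by decide), hA1, hA2,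
      by simp [Store.setN, NExpr.eval], by simp [Store.setN, h10]⟩

theorem topKProg (hkd : k ≤ d) (h : Fin d → ℕ) (ε β : ℝ) :
    Yields ([topKProg], inputStore h k ε β)
      (k * 21 + d * 20 + threshold d k ε β * (k * 8 + 20) + 50)
      (targetLaw h k ε (threshold d k ε β)) := by
  have h0 : Ctx h k ε β 0 0 0 (inputStore h k ε β) := by
    constructor <;> simp [inputStore]
  refine mono (.seq (.thresholdProg h0 fun s₁ h₁ => .seq (.packProg h₁ fun s₂ h₂ =>
    .seq (.sortProg h₂ fun s₃ h₃ hA1 hA2 => .seq (.reservoirProg hkd h₃ hA1 hA2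
      fun R s₄ h₄ hA1 hA2 h10 => .shuffleProg hkd h₄ hA1 hA2 h10))))) (by omega)

end Yields

/-! ### Final time and space bounds -/

theorem samplesWithin_topKProg {d k : ℕ} (hk : 1 ≤ k) (hkd : k ≤ d) {ε β : ℝ} (hε : 0 < ε)
    (hβ : 0 < β) (hβ1 : β < 1) (h : Fin d → ℕ) :
    SamplesWithin topKProg h ε β (topKMechanism (k := k) hkd ε β h)
      (200 * (d + k * threshold d k ε β)) (200 * (d + k * threshold d k ε β)) := by
  set τ := threshold d k ε β with hτ
  -- The lower-order terms are absorbed using `1 ≤ k ≤ d`. The time constant is 199 because space is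
  -- at most the `d` input cells plus the time, which then fits into 200.
  have hle : k * 21 + d * 20 + τ * (k * 8 + 20) + 50 ≤ 199 * (d + k * τ) := by
    have h1 : τ ≤ k * τ := Nat.le_mul_of_pos_left τ hk
    have h2 : τ * (k * 8 + 20) = 8 * (k * τ) + 20 * τ := by ring
    omega
  have hy := (Yields.topKProg hkd h ε β).mono hle
  have hy' := hy.mono (Nat.mul_le_mul_right (d + k * τ) (by norm_num : 199 ≤ 200))
  refine ⟨fun c hc => ⟨hy'.1 c hc, ?_⟩, ?_⟩
  · have hrun : run (200 * (d + k * τ)) ([topKProg], inputStore h k ε β) =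
        run (199 * (d + k * τ)) ([topKProg], inputStore h k ε β) := by
      rw [show 200 * (d + k * τ) = 199 * (d + k * τ) + (d + k * τ) by ring]
      exact hy.run_eq _
    rw [hrun] at hc
    have h1 := card_touched_run _ _ c hc
    have h2 := card_touched_inputStore h k ε β
    simp only at h1
    omega
  · rw [hy'.2, targetLaw_eq hk hkd hε hβ hβ1 h]

end TopK

theorem theorem1 :
    (∀ (d k : ℕ) (_hk : 1 ≤ k) (hkd : k ≤ d) (ε β : ℝ), 0 < ε → 0 < β → β < 1 →
      IsDP (Neighbor (d := d)) (topKMechanism (k := k) hkd ε β) ε 0 ∧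
      ∀ h : Fin d → ℕ,
        (topKMechanism (k := k) hkd ε β h).toOuterMeasure
            {s | (threshold d k ε β : ℝ) ≤ jointLoss hkd h s} ≤ ENNReal.ofReal β) ∧
    ∃ (P : Prog) (C : ℕ),
      ∀ (d k : ℕ) (_hk : 1 ≤ k) (hkd : k ≤ d) (ε β : ℝ), 0 < ε → 0 < β → β < 1 →
        ∀ h : Fin d → ℕ,
          SamplesWithin P h ε β (topKMechanism (k := k) hkd ε β h)
            (C * (d + k * threshold d k ε β)) (C * (d + k * threshold d k ε β)) :=
  ⟨fun _ _ hk hkd _ _ hε hβ hβ1 => ⟨isDP_topKMechanism hk hkd hε hβ hβ1,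
    topKMechanism_tail_le hk hkd hε hβ hβ1⟩,
    topKProg, 200, fun _ _ hk hkd _ _ hε hβ hβ1 => samplesWithin_topKProg hk hkd hε hβ hβ1⟩
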